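/- Let $\mathbf P$ (nouns) and $\mathbf R$ (verbs) be sets whose elements are named by binary strings. *Terms* are generated from nouns $p$ by a chosen collection of the term formers $(r\ \mathsf{all}\ x)$, $(r\ \mathsf{some}\ x)$, $\overline{x}$ (with $r\in\mathbf R$ and $x$ a term), and *sentences* are generated from terms by a chosen collection of the sentence formers $(\mathsf{all}\ x\ y)$, $(\mathsf{some}\ x\ y)$, $(\mathsf{all}\ a\ b\ \mathsf{or\ some}\ x\ y)$, $[x_1,\dots,x_n]$, $\langle x_1,\dots,x_n\rangle$ ($n\ge 1$). Such a choice is a *language* $\mathcal L$; a *theory* is a set of sentences of $\mathcal L$. A *model* is a (possibly empty) set $M$ with a subset $[\![p]\!]\subseteq M$ for each noun and a relation $[\![r]\!]\subseteq M\times M$ for each verb. Put $[\![r\ \mathsf{all}\ x]\!]=\{m : m\,[\![r]\!]\,n \text{ for all } n\in[\![x]\!]\}$, $[\![r\ \mathsf{some}\ x]\!]=\{m : m\,[\![r]\!]\,n \text{ for some } n\in[\![x]\!]\}$, $[\![\overline x]\!]=M\setminus[\![x]\!]$. The sentences are true under the following conditions, respectively: $[\![x]\!]\subseteq[\![y]\!]$;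 $[\![x]\!]\cap[\![y]\!]\ne\emptyset$; $[\![a]\!]\subseteq[\![b]\!]$ or $[\![x]\!]\cap[\![y]\!]\ne\emptyset$; $\bigcap_i[\![x_i]\!]=\emptyset$; $\bigcap_i[\![x_i]\!]\neq\emptyset$. We write $\Gamma\models\varphi$ if every model of the theory $\Gamma$ satisfies the sentence $\varphi$. *Term templates* and *sentence templates* are formed like terms and sentences of $\mathcal L$, but with noun and verb variables in place of nouns and verbs, and with term variables and sentence variables as additional term templates and sentence templates, respectively. A *syllogistic rule* consists of finitely many (possibly no) sentence templates as premises and one sentence template as conclusion; its substitution instances arise by substituting nouns, verbs, terms and sentences of $\mathcal L$ for the corresponding variables. A *syllogistic proof system* $\vdash$ is a finite set of syllogistic rules. A *proof tree over $\Gamma$* is a finite tree labelled by sentences in which every node either is a leaf labelled by an element of $\Gamma$, or is the conclusion, and its children the premises, of a substitution instance of a rule. For a set $A$ of sentences, $\Gamma\vdash_A\varphi$ means that there is a proof tree over $\Gamma$ with root $\varphi$, all of whose labels belong to $A$; and $\Gamma\vdash\varphi$ means that there is a proof tree over $\Gamma$ with root $\varphi$ and arbitrary labels. The system is *sound* if $\Gamma\vdash\varphi$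 implies $\Gamma\models\varphi$, and *complete* if $\Gamma\models\varphi$ implies $\Gamma\vdash\varphi$, for all theories $\Gamma$ (finite or infinite) and all sentences $\varphi$. It is *boundedly complete* if it is sound and there is a polynomial-time computable function $f$ from finite sets of sentences to finite sets of sentences such that, for all finite theories $\Gamma$ and all sentences $\varphi$, if $\Gamma\models\varphi$ then $\Gamma\vdash_{f(\Gamma\cup\{\varphi\})}\varphi$. (For computations, a sentence is written as a string over a finite alphabet and a finite set as a list of its elements.) **Theorem.** Let $\vdash$ be a boundedly complete syllogistic proof system for a language $\mathcal L$. Then $\vdash$ is complete, and the problem of deciding, given a finite theory $\Gamma$ and a sentence $\varphi$ of $\mathcal L$, whether $\Gamma\models\varphi$, is in $\mathrm{PTIME}$. -/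

import Mathlib

namespace Syllogistic

/-! ### Syntax and semantics -/

/-- A language is given by the choice of its term formers and sentence formers.  Nouns are always
terms.  The optional term formers are `(r all x)`, `(r some x)` and complementation; the optional
sentence formers are `(all x y)`, `(some x y)`, the four-place `(all a b or some x y)`, and the
sentences `[x₁, …, xₙ]` and `⟨x₁, …, xₙ⟩` for `n ≥ 1`. -/
structure Language where
  allTerm : Prop
  someTerm : Prop
  compl : Prop
  all : Prop
  some : Prop
  allOrSome : Prop
  disjoint : Prop
  overlap : Prop

/-- Terms of the language `L` over the set `P` of nouns and the set `R` of verbs. -/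
inductive Term (L : Language) (P R : Type) : Type
  | noun (p : P) : Term L P R
  | allTerm (h : L.allTerm) (r : R) (x : Term L P R) : Term L P R
  | someTerm (h : L.someTerm) (r : R) (x : Term L P R) : Term L P R
  | compl (h : L.compl) (x : Term L P R) : Term L P R

/-- Sentences of `L`.  `disjoint h x xs` and `overlap h x xs` are the sentences `[x, xs…]` and
`⟨x, xs…⟩` on the nonempty list `x :: xs` of terms. -/
inductive Sentence (L : Language) (P R : Type) : Type
  | all (h : L.all) (x y : Term L P R) : Sentence L P R
  | some (h : L.some) (x y : Term L P R) : Sentence L P R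
  | allOrSome (h : L.allOrSome) (a b x y : Term L P R) : Sentence L P R
  | disjoint (h : L.disjoint) (x : Term L P R) (xs : List (Term L P R)) : Sentence L P R
  | overlap (h : L.overlap) (x : Term L P R) (xs : List (Term L P R)) : Sentence L P R

/-- A model: a (possibly empty) set, a subset for each noun, a binary relation for each verb. -/
structure Model (P R : Type) where
  carrier : Type
  noun : P → Set carrier
  verb : R → carrier → carrier → Prop

variable {L : Language} {P R : Type}

/-- The interpretation of a term in a model. -/
def Term.interp (M : Model P R) : Term L P R → Set M.carrier
  | .noun p => M.noun p
  | .allTerm _ r x => {m | ∀ n ∈ x.interp M, M.verb r m n}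
  | .someTerm _ r x => {m | ∃ n ∈ x.interp M, M.verb r m n}
  | .compl _ x => (x.interp M)ᶜ

/-- Truth of a sentence in a model. -/
def Sentence.Holds (M : Model P R) : Sentence L P R → Prop
  | .all _ x y => x.interp M ⊆ y.interp M
  | .some _ x y => (x.interp M ∩ y.interp M).Nonempty
  | .allOrSome _ a b x y => a.interp M ⊆ b.interp M ∨ (x.interp M ∩ y.interp M).Nonempty
  | .disjoint _ x xs => {m | ∀ t ∈ x :: xs, m ∈ t.interp M} = ∅
  | .overlap _ x xs => {m | ∀ t ∈ x :: xs, m ∈ t.interp M}.Nonempty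

/-- The consequence relation `Γ ⊨ φ`: every model of the theory `Γ` satisfies `φ`.  -/
def Entails (Γ : Set (Sentence L P R)) (φ : Sentence L P R) : Prop :=
  ∀ M : Model P R, (∀ ψ ∈ Γ, ψ.Holds M) → φ.Holds M

/-! ### Syllogistic proof systems -/

/-- Term templates: noun, verb and term variables are all indexed by natural numbers. -/
inductive TermTemplate (L : Language) : Type
  | nounVar (p : ℕ) : TermTemplate L
  | termVar (x : ℕ) : TermTemplate L
  | allTerm (h : L.allTerm) (r : ℕ) (x : TermTemplate L) : TermTemplate L
  | someTerm (h : L.someTerm) (r : ℕ) (x : TermTemplate L) : TermTemplate L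
  | compl (h : L.compl) (x : TermTemplate L) : TermTemplate L

/-- Sentence templates; sentence variables are indexed by natural numbers. -/
inductive SentenceTemplate (L : Language) : Type
  | sentVar (n : ℕ) : SentenceTemplate L
  | all (h : L.all) (x y : TermTemplate L) : SentenceTemplate L
  | some (h : L.some) (x y : TermTemplate L) : SentenceTemplate L
  | allOrSome (h : L.allOrSome) (a b x y : TermTemplate L) : SentenceTemplate L
  | disjoint (h : L.disjoint) (x : TermTemplate L) (xs : List (TermTemplate L)) :
      SentenceTemplate L
  | overlap (h : L.overlap) (x : TermTemplate L) (xs : List (TermTemplate L)) :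
      SentenceTemplate L

/-- A syllogistic rule: finitely many premises and a conclusion. -/
structure Rule (L : Language) where
  premises : List (SentenceTemplate L)
  conclusion : SentenceTemplate L

/-- A syllogistic proof system is a finite set of syllogistic rules. -/
abbrev ProofSystem (L : Language) : Type := Finset (Rule L)

/-- A substitution assigns nouns, verbs, terms and sentences to variables.  It is partial, since it
has to be defined only on the variables that occur in the rule it is applied to (for instance, a
rule without verb variables has instances even if there are no verbs). -/
structure Substitution (L : Language) (P R : Type) where
  noun : ℕ → Option P
  verb : ℕ → Option R
  term : ℕ → Option (Term L P R)
  sent : ℕ → Option (Sentence L P R)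

/-- The result of a substitution in a term template, if the substitution is defined on all of its
variables. -/
def TermTemplate.subst (σ : Substitution L P R) : TermTemplate L → Option (Term L P R)
  | .nounVar p => (σ.noun p).map Term.noun
  | .termVar x => σ.term x
  | .allTerm h r x => (σ.verb r).bind fun r' => (x.subst σ).map (Term.allTerm h r')
  | .someTerm h r x => (σ.verb r).bind fun r' => (x.subst σ).map (Term.someTerm h r')
  | .compl h x => (x.subst σ).map (Term.compl h)

/-- The result of a substitution in a sentence template, if the substitution is defined on all of
its variables. -/
def SentenceTemplate.subst (σ : Substitution L P R) : SentenceTemplate L → Option (Sentence L P R)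
  | .sentVar n => σ.sent n
  | .all h x y => (x.subst σ).bind fun x' => (y.subst σ).map (Sentence.all h x')
  | .some h x y => (x.subst σ).bind fun x' => (y.subst σ).map (Sentence.some h x')
  | .allOrSome h a b x y =>
      (a.subst σ).bind fun a' => (b.subst σ).bind fun b' => (x.subst σ).bind fun x' =>
        (y.subst σ).map (Sentence.allOrSome h a' b' x')
  | .disjoint h x xs =>
      (x.subst σ).bind fun x' => (xs.mapM (TermTemplate.subst σ)).map (Sentence.disjoint h x')
  | .overlap h x xs =>
      (x.subst σ).bind fun x' => (xs.mapM (TermTemplate.subst σ)).map (Sentence.overlap h x')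

/-- `ρ.IsInstance premises φ`: the inference from `premises` to `φ` is a substitution instance of
the rule `ρ`. -/
def Rule.IsInstance (ρ : Rule L) (premises : List (Sentence L P R)) (φ : Sentence L P R) : Prop :=
  ∃ σ : Substitution L P R,
    ρ.premises.mapM (SentenceTemplate.subst σ) = Option.some premises ∧
      ρ.conclusion.subst σ = Option.some φ

/-- `Γ ⊢_A φ`: there is a proof tree over the theory `Γ` with root `φ`, all of whose nodes are
labelled by sentences in `A`. -/
inductive ProvableWithin (S : ProofSystem L) (A Γ : Set (Sentence L P R)) : Sentence L P R → Prop
  | leaf {φ : Sentence L P R} (hA : φ ∈ A) (hΓ : φ ∈ Γ) : ProvableWithin S A Γ φ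
  | rule {φ : Sentence L P R} (hA : φ ∈ A) (ρ : Rule L) (hρ : ρ ∈ S)
      (premises : List (Sentence L P R)) (hinst : ρ.IsInstance premises φ)
      (hprem : ∀ ψ ∈ premises, ProvableWithin S A Γ ψ) : ProvableWithin S A Γ φ

/-- `Γ ⊢ φ`: there is a proof tree over `Γ` with root `φ`. -/
def Provable (S : ProofSystem L) (Γ : Set (Sentence L P R)) (φ : Sentence L P R) : Prop :=
  ProvableWithin S Set.univ Γ φ

/-- Soundness of a proof system, over the nouns `P` and the verbs `R`. -/
def Sound (P R : Type) (S : ProofSystem L) : Prop :=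
  ∀ (Γ : Set (Sentence L P R)) (φ : Sentence L P R), Provable S Γ φ → Entails Γ φ

/-- Completeness of a proof system, over the nouns `P` and the verbs `R`, for arbitrary (possibly
infinite) theories. -/
def Complete (P R : Type) (S : ProofSystem L) : Prop :=
  ∀ (Γ : Set (Sentence L P R)) (φ : Sentence L P R), Entails Γ φ → Provable S Γ φ

/-! ### Sentences as strings, and polynomial time -/

/-- The finite alphabet in which sentences are written. -/
inductive Letter : Type
  | bit (b : Bool)
  | endMark
  | turnstile
  | noun
  | allTerm
  | someTerm
  | compl
  | all
  | some
  | allOrSome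
  | disjoint
  | overlap
  deriving DecidableEq, Fintype

/-- A noun or verb with code `w` is written as the bits of `w` followed by an end marker. -/
def encodeName (w : List Bool) : List Letter :=
  w.map Letter.bit ++ [Letter.endMark]

/-- Terms are written in prefix notation; `cP` and `cR` are the binary codes of nouns and verbs. -/
def Term.encode (cP : P → List Bool) (cR : R → List Bool) : Term L P R → List Letter
  | .noun p => Letter.noun :: encodeName (cP p)
  | .allTerm _ r x => Letter.allTerm :: (encodeName (cR r) ++ x.encode cP cR)
  | .someTerm _ r x => Letter.someTerm :: (encodeName (cR r) ++ x.encode cP cR)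
  | .compl _ x => Letter.compl :: x.encode cP cR

/-- Sentences are written in prefix notation. -/
def Sentence.encode (cP : P → List Bool) (cR : R → List Bool) : Sentence L P R → List Letter
  | .all _ x y => Letter.all :: (x.encode cP cR ++ y.encode cP cR)
  | .some _ x y => Letter.some :: (x.encode cP cR ++ y.encode cP cR)
  | .allOrSome _ a b x y =>
      Letter.allOrSome ::
        (a.encode cP cR ++ b.encode cP cR ++ x.encode cP cR ++ y.encode cP cR)
  | .disjoint _ x xs =>
      Letter.disjoint :: ((x :: xs).flatMap (Term.encode cP cR) ++ [Letter.endMark])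
  | .overlap _ x xs =>
      Letter.overlap :: ((x :: xs).flatMap (Term.encode cP cR) ++ [Letter.endMark])

/-- A finite theory is written by listing its sentences one after the other. -/
def encodeTheory (cP : P → List Bool) (cR : R → List Bool) (Γ : List (Sentence L P R)) :
    List Letter :=
  Γ.flatMap (Sentence.encode cP cR)

/-- An input `(Γ, φ)` of the consequence problem is written as `Γ`, a separator, and `φ`. -/
def encodeInput (cP : P → List Bool) (cR : R → List Bool)
    (i : List (Sentence L P R) × Sentence L P R) : List Letter :=
  encodeTheory cP cR i.1 ++ Letter.turnstile :: i.2.encode cP cR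

open scoped Classical in
/-- A function on finite sets of sentences is computable in polynomial time if a Turing machine
computes it in polynomial time when finite sets are represented by lists of their elements (in any
order, repetitions allowed). -/
def PTimeComputable (cP : P → List Bool) (cR : R → List Bool)
    (f : Finset (Sentence L P R) → Finset (Sentence L P R)) : Prop :=
  ∃ F : List (Sentence L P R) → List (Sentence L P R),
    (∀ Δ, (F Δ).toFinset = f Δ.toFinset) ∧
      Nonempty (Turing.TM2ComputableInPolyTime (encodeTheory cP cR) (encodeTheory cP cR) F)

open scoped Classical in
/-- A boundedly complete syllogistic proof system: it is sound, and there is a polynomial time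
computable `f` such that, for finite `Γ`, if `Γ ⊨ φ` then `Γ ⊢_A φ` with `A = f (Γ ∪ {φ})`. -/
def BoundedlyComplete (cP : P → List Bool) (cR : R → List Bool) (S : ProofSystem L) : Prop :=
  Sound P R S ∧
    ∃ f : Finset (Sentence L P R) → Finset (Sentence L P R),
      PTimeComputable cP cR f ∧
        ∀ (Γ : Finset (Sentence L P R)) (φ : Sentence L P R),
          Entails (Γ : Set (Sentence L P R)) φ →
            ProvableWithin S (f (Γ ∪ {φ}) : Set (Sentence L P R)) (Γ : Set (Sentence L P R)) φ

/-- The consequence relation of `L` is in PTIME: a Turing machine decides in polynomial time, given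
a finite theory `Γ` and a sentence `φ`, whether `Γ ⊨ φ`. -/
def ConsequenceInPTime (L : Language) (cP : P → List Bool) (cR : R → List Bool) : Prop :=
  ∃ D : List (Sentence L P R) × Sentence L P R → Bool,
    (∀ Γ φ, D (Γ, φ) = true ↔ Entails {ψ | ψ ∈ Γ} φ) ∧
      Nonempty (Turing.TM2ComputableInPolyTime (encodeInput cP cR) Computability.encodeBool D)

end Syllogistic

/-! Completeness is compactness. If `Γ` entails `φ`, then some finite `Δ ⊆ Γ` already does
(`Entails.exists_finset`); bounded completeness gives a proof tree over `Δ`, which is also one over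
`Γ`. Compactness comes from an ultraproduct: without equality in the language, the full product of
the factors satisfies Łoś's theorem with no quotient (`mem_interp_prodModel`, `holds_prodModel`).
Empty models need separate care, since one empty factor empties the whole product
(`exists_holds_iff_eventually`).

For decidability, compute `A = f (Γ ∪ {φ})` and chain forward inside `A`: starting from nothing,
pass repeatedly to the members of `A` that lie in `Γ` or follow by one rule from what has been
found. The stages increase within `A`, so `|A|` rounds reach the fixed point, which is the set of
sentences provable from `Γ` within `A` (`mem_derivable_iff`). Membership of `φ` in it is equivalent
to entailment: soundness gives one direction, bounded completeness the other. A round is polynomial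
because the rules are fixed: a rule with `k` premises is tried on at most `|A| ^ k` choices of
premises, and each trial is a matching of templates (`Rule.fires_iff`).

Most of the work is to obtain an actual Turing machine. Stack programs (`Prog`) with a cost
semantics (`Runs`) are compiled to machines (`Runs.steps`, `polyTime_of_runs`); the machine for `f`
is embedded as an oracle (`liftStmt`). Data are trees kept as prefix codes on a stack, and `PT`
denotes polynomial-time computability on them. This class is closed under composition, pairing, case
distinction and folds with additive growth (`PT.foldl`), and these closure properties cover parsing,
matching and chaining. -/

namespace Syllogistic
open Function

/-! ### Binary trees and their codes -/

/-- Binary trees with leaves labelled by letters, the data type of the programs below. -/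
inductive Tree : Type
  | leaf (a : Letter)
  | node (l r : Tree)
  deriving DecidableEq

/-- Symbols of the registers: `none` announces a node, `some a` is a leaf. -/
abbrev Sym : Type := Option Letter

namespace Tree

/-- The prefix code of a tree. -/
def code : Tree → List Sym
  | leaf a => [some a]
  | node l r => none :: (l.code ++ r.code)

/-- The number of symbols of the code. -/
def size (x : Tree) : ℕ := x.code.length

@[simp] theorem code_leaf (a : Letter) : (leaf a).code = [some a] := rfl
@[simp] theorem code_node (l r : Tree) : (node l r).code = none :: (l.code ++ r.code) := rfl
@[simp] theorem size_leaf (a : Letter) : (leaf a).size = 1 := rfl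
@[simp] theorem size_node (l r : Tree) : (node l r).size = l.size + r.size + 1 := by
  simp [size]

/-- A prefix code is self-delimiting. The remainders `r` and `s` are carried along because the right
subtree is read from what the left one leaves over. -/
theorem code_append_inj {x y : Tree} {r s : List Sym} (h : x.code ++ r = y.code ++ s) :
    x = y ∧ r = s := by
  induction x generalizing y r s with
  | leaf a => cases y <;> simp_all
  | node l₁ r₁ ih₁ ih₂ =>
    cases y with
    | leaf a => simp at h
    | node l₂ r₂ =>
      simp only [code_node, List.cons_append, List.append_assoc, List.cons.injEq, true_and] at h
      obtain ⟨rfl, h₁⟩ := ih₁ h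
      obtain ⟨rfl, h₂⟩ := ih₂ h₁
      exact ⟨rfl, h₂⟩

theorem code_injective : Injective code := fun x y h =>
  (code_append_inj (r := []) (s := []) (by simpa using h)).1

end Tree

/-! ### Stack programs -/

/-- The registers of a stack program. -/
inductive Reg : Type
  | main
  | aux
  | tmp
  | tmp'
  | cnt
  deriving DecidableEq

instance : Fintype Reg where
  elems := {.main, .aux, .tmp, .tmp', .cnt}
  complete := by rintro (_ | _) <;> simp

/-- Stack programs.  `pop r p` pops a symbol and continues with the program chosen by it,
`loop r b p` does the same as long as the popped symbol satisfies `b`, and `call` replaces the word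
in the register `tmp` by the answer of an oracle. -/
inductive Prog : Type
  | skip
  | push (r : Reg) (a : Sym)
  | pop (r : Reg) (p : Option Sym → Prog)
  | seq (p q : Prog)
  | loop (r : Reg) (b : Option Sym → Bool) (p : Option Sym → Prog)
  | call

/-- The contents of the registers. -/
abbrev Store : Type := Reg → List Sym

/-- `Runs O p S S' t`: the program `p` takes the store `S` to the store `S'` at a cost of at most
`t`, if the oracle answers `s'` to `s` at a cost of at most `t` when `O s s' t`. -/
inductive Runs (O : List Letter → List Letter → ℕ → Prop) : Prog → Store → Store → ℕ → Prop
  | skip (S) : Runs O .skip S S 1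
  | push (r a S) : Runs O (.push r a) S (update S r (a :: S r)) 1
  | pop {r p S S' t} (h : Runs O (p (S r).head?) (update S r (S r).tail) S' t) :
      Runs O (.pop r p) S S' (t + 1)
  | seq {p q S S' S'' t t'} (h : Runs O p S S' t) (h' : Runs O q S' S'' t') :
      Runs O (.seq p q) S S'' (t + t')
  | loop_exit {r b p S} (h : b (S r).head? = false) :
      Runs O (.loop r b p) S (update S r (S r).tail) 1
  | loop_next {r b p S S' S'' t t'} (h : b (S r).head? = true)
      (h₁ : Runs O (p (S r).head?) (update S r (S r).tail) S' t)
      (h₂ : Runs O (.loop r b p) S' S'' t') : Runs O (.loop r b p) S S'' (t + t' + 1)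
  | call {S s s' t} (h : S .tmp = s.reverse.map some) (h' : O s s' t) :
      Runs O .call S (update S .tmp (s'.reverse.map some)) (t + s.length + s'.length + 2)
  | mono {p S S' t t'} (h : Runs O p S S' t) (h' : t ≤ t') : Runs O p S S' t'

theorem length_update_tail_le (S : Store) (r r' : Reg) :
    (update S r' (S r').tail r).length ≤ (S r).length := by
  by_cases h : r = r' <;> simp [h]

/-- No instruction lengthens a register by more than its cost; this is why the cost of `call`
includes the length of the answer. Sizes of results are thereby bounded by running times. -/
theorem Runs.length_le {O p S S' t} (h : Runs O p S S' t) (r : Reg) :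
    (S' r).length ≤ (S r).length + t := by
  induction h generalizing r with
  | skip => omega
  | push r' a S => by_cases h : r = r' <;> simp [h]
  | @pop r' p S S' t h ih => have := ih r; have := length_update_tail_le S r r'; omega
  | seq _ _ ih ih' => have := ih r; have := ih' r; omega
  | @loop_exit r' b p S h => have := length_update_tail_le S r r'; omega
  | @loop_next r' b p S S' S'' t t' h h₁ h₂ ih ih' =>
    have := ih r; have := ih' r; have := length_update_tail_le S r r'; omega
  | @call S s s' t h h' => by_cases h : r = .tmp <;> simp [h]; omega
  | mono _ h' ih => have := ih r; omega

end Syllogistic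

namespace Syllogistic
open Function Turing

/-! ### Compilation of stack programs to Turing machines -/

/-- `Steps f n a b`: the transition function `f` leads from `a` to `b` in `n` steps. -/
def Steps {α : Type} (f : α → Option α) (n : ℕ) (a b : α) : Prop :=
  (flip bind f)^[n] (some a) = some b

section Steps
variable {α : Type} {f : α → Option α}

theorem Steps.refl (a : α) : Steps f 0 a a := rfl

theorem Steps.head {n : ℕ} {a b c : α} (h : f a = some b) (h' : Steps f n b c) :
    Steps f (n + 1) a c := by
  unfold Steps at *
  rw [iterate_succ_apply]
  have : flip bind f (some a) = some b := h
  rw [this, h']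

theorem Steps.single {a b : α} (h : f a = some b) : Steps f 1 a b := Steps.head h (Steps.refl b)

theorem Steps.trans {m n : ℕ} {a b c : α} (h : Steps f m a b) (h' : Steps f n b c) :
    Steps f (m + n) a c := by
  unfold Steps at *
  rw [add_comm, iterate_add_apply, h, h']

theorem iterate_flip_bind_none (n : ℕ) : (flip bind f)^[n] none = none := by
  induction n with
  | zero => rfl
  | succ n ih => rw [iterate_succ_apply]; exact ih

theorem Steps.exists_head {n : ℕ} {a c : α} (h : Steps f (n + 1) a c) :
    ∃ b, f a = some b ∧ Steps f n b c := by
  unfold Steps at *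
  rw [iterate_succ_apply] at h
  have e : flip bind f (some a) = f a := rfl
  rw [e] at h
  cases hf : f a with
  | none => rw [hf, iterate_flip_bind_none] at h; cases h
  | some b => exact ⟨b, rfl, by rw [← hf]; exact h⟩

end Steps

/-- The stacks of a machine that runs a stack program: an input and an output stack, the registers
and the stacks of an oracle machine. -/
inductive Stk (K : Type) : Type
  | inp
  | out
  | reg (r : Reg)
  | sub (k : K)
  deriving DecidableEq

instance Stk.finite (K : Type) [Finite K] : Finite (Stk K) := by
  let e : Stk K → Option (Option (Reg ⊕ K)) := fun
    | .inp => none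
    | .out => some none
    | .reg r => some (some (.inl r))
    | .sub k => some (some (.inr k))
  refine Finite.of_injective e fun a b h => ?_
  cases a <;> cases b <;> simp_all [e]

section Compile

/-- A machine that serves as an oracle on words. -/
abbrev Oracle : Type 1 := TM2ComputableAux Letter Letter

variable (A : Oracle)

/-- The stack alphabets. -/
@[reducible] def Stk.Γ : Stk A.tm.K → Type
  | .inp => Letter
  | .out => Bool
  | .reg _ => Sym
  | .sub k => A.tm.Γ k

/-- The internal state: that of the oracle machine, and the last symbol that was popped. -/
abbrev St : Type := A.tm.σ × Option Sym

/-- Statements of the compiled machine. -/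
abbrev CStmt (Λ : Type) : Type := TM2.Stmt (Stk.Γ A) Λ (St A)

/-- The contents of all stacks. -/
def contents (i : List Letter) (o : List Bool) (S : Store) (Z : ∀ k, List (A.tm.Γ k)) :
    ∀ k, List (Stk.Γ A k)
  | .inp => i
  | .out => o
  | .reg r => S r
  | .sub k => Z k

variable {A}

theorem contents_nil : contents A [] [] (fun _ => []) (fun _ => []) = fun _ => [] := by
  funext k; cases k <;> rfl

theorem update_contents_inp (i o S Z) (x : List Letter) :
    update (contents A i o S Z) .inp x = contents A x o S Z := by
  funext k; cases k <;> rfl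

theorem update_contents_out (i o S Z) (x : List Bool) :
    update (contents A i o S Z) .out x = contents A i x S Z := by
  funext k; cases k <;> rfl

theorem update_contents_reg (i o S Z r) (x : List Sym) :
    update (contents A i o S Z) (.reg r) x = contents A i o (update S r x) Z := by
  funext k
  cases k with
  | reg r' =>
    by_cases h : r' = r
    · subst h
      have e : update S r' x r' = x := update_self ..
      exact (update_self ..).trans e.symm
    · have : Stk.reg (K := A.tm.K) r' ≠ .reg r := by simpa using h
      exact (update_of_ne this ..).trans (update_of_ne h ..).symm
  | _ => rfl

theorem update_contents_sub (i o S Z) (k₀ : A.tm.K) (x : List (A.tm.Γ k₀)) :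
    update (contents A i o S Z) (.sub k₀) x = contents A i o S (update Z k₀ x) := by
  funext k
  cases k with
  | sub k =>
    by_cases h : k = k₀
    · subst h
      have e : update Z k x k = x := update_self ..
      exact (update_self ..).trans e.symm
    · have : Stk.sub k ≠ .sub k₀ := by simpa using h
      exact (update_of_ne this ..).trans (update_of_ne h ..).symm
  | _ => rfl

variable (A)

/-- A statement of the oracle machine as a part of the compiled machine, which continues at the
label `x` instead of halting. -/
def liftStmt {Λ : Type} (ι : A.tm.Λ → Λ) (x : Λ) : TM2.Stmt A.tm.Γ A.tm.Λ A.tm.σ → CStmt A Λ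
  | .push k f q => .push (.sub k) (fun v => f v.1) (liftStmt ι x q)
  | .peek k f q => .peek (.sub k) (fun v a => (f v.1 a, v.2)) (liftStmt ι x q)
  | .pop k f q => .pop (.sub k) (fun v a => (f v.1 a, v.2)) (liftStmt ι x q)
  | .load f q => .load (fun v => (f v.1, v.2)) (liftStmt ι x q)
  | .branch f q q' => .branch (fun v => f v.1) (liftStmt ι x q) (liftStmt ι x q')
  | .goto f => .goto (fun v => ι (f v.1))
  | .halt => .goto (fun _ => x)

/-- A configuration of the oracle machine as a configuration of the compiled machine. -/
def liftCfg {Λ : Type} (ι : A.tm.Λ → Λ) (x : Λ) (y : Option Sym) (i : List Letter)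
    (o : List Bool) (S : Store) (c : TM2.Cfg A.tm.Γ A.tm.Λ A.tm.σ) : TM2.Cfg (Stk.Γ A) Λ (St A) :=
  ⟨some (c.l.elim x ι), (c.var, y), contents A i o S c.stk⟩

theorem stepAux_liftStmt {Λ : Type} (ι : A.tm.Λ → Λ) (x : Λ) (y : Option Sym) (i o S) (q v Z) :
    TM2.stepAux (liftStmt A ι x q) (v, y) (contents A i o S Z) =
      liftCfg A ι x y i o S (TM2.stepAux q v Z) := by
  induction q generalizing v Z with
  | push k f q ih => simp only [liftStmt, TM2.stepAux, ← ih, ← update_contents_sub]; rfl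
  | peek k f q ih => simp only [liftStmt, TM2.stepAux, ← ih]; rfl
  | pop k f q ih => simp only [liftStmt, TM2.stepAux, ← ih, ← update_contents_sub]; rfl
  | load f q ih => simp only [liftStmt, TM2.stepAux, ← ih]
  | branch f q q' ih ih' => simp only [liftStmt, TM2.stepAux]; cases f v <;> simp [ih, ih']
  | goto f => rfl
  | halt => rfl

/-- A halted configuration of the oracle machine is lifted to one at the label `x`, so that control
returns to the surrounding program. -/
theorem Steps.lift {Λ : Type} (ι : A.tm.Λ → Λ) (x : Λ) (y : Option Sym) (i o S)
    (M : Λ → CStmt A Λ) (hM : ∀ l, M (ι l) = liftStmt A ι x (A.tm.m l)) {n : ℕ}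
    {c c' : TM2.Cfg A.tm.Γ A.tm.Λ A.tm.σ} (h : Steps (TM2.step A.tm.m) n c c') :
    Steps (TM2.step M) n (liftCfg A ι x y i o S c) (liftCfg A ι x y i o S c') := by
  induction n generalizing c with
  | zero => cases h; exact Steps.refl _
  | succ n ih =>
    obtain ⟨d, hd, h⟩ := h.exists_head
    refine Steps.head ?_ (ih h)
    obtain ⟨l, v, Z⟩ := c
    cases l with
    | none => cases hd
    | some l =>
      simp only [TM2.step, Option.some.injEq] at hd
      rw [← hd, ← stepAux_liftStmt]
      simp [liftCfg, TM2.step, hM]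

/-- The labels of the compiled program. -/
inductive Label : Prog → Type
  | skip : Label .skip
  | push (r : Reg) (a : Sym) : Label (.push r a)
  | pop (r : Reg) (p : Option Sym → Prog) : Label (.pop r p)
  | popIn (r : Reg) (p : Option Sym → Prog) (a : Option Sym) (l : Label (p a)) : Label (.pop r p)
  | seqLeft (p q : Prog) (l : Label p) : Label (.seq p q)
  | seqRight (p q : Prog) (l : Label q) : Label (.seq p q)
  | loop (r : Reg) (b : Option Sym → Bool) (p : Option Sym → Prog) : Label (.loop r b p)
  | loopIn (r : Reg) (b : Option Sym → Bool) (p : Option Sym → Prog) (a : Option Sym)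
      (l : Label (p a)) : Label (.loop r b p)
  | load : Label .call
  | run (l : A.tm.Λ) : Label .call
  | unload : Label .call

/-- The continuations of `pop` and `loop` are indexed by the finite type `Option Sym`, so finiteness
passes through the sigma types. -/
theorem Label.finite (p : Prog) : Finite (Label A p) := by
  induction p with
  | skip => exact .of_surjective (fun _ : Unit => .skip) fun l => by cases l; simp
  | push r a => exact .of_surjective (fun _ : Unit => .push r a) fun l => by cases l; simp
  | pop r p ih =>
    exact .of_surjective (fun l : Option (Σ a, Label A (p a)) =>
      l.elim (.pop r p) fun l => .popIn r p l.1 l.2) fun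
        | .pop r p => ⟨none, rfl⟩
        | .popIn r p a l => ⟨some ⟨a, l⟩, rfl⟩
  | seq p q ih ih' =>
    exact .of_surjective (fun l : Label A p ⊕ Label A q => l.elim (.seqLeft p q) (.seqRight p q)) fun
      | .seqLeft p q l => ⟨.inl l, rfl⟩
      | .seqRight p q l => ⟨.inr l, rfl⟩
  | loop r b p ih =>
    exact .of_surjective (fun l : Option (Σ a, Label A (p a)) =>
      l.elim (.loop r b p) fun l => .loopIn r b p l.1 l.2) fun
        | .loop r b p => ⟨none, rfl⟩
        | .loopIn r b p a l => ⟨some ⟨a, l⟩, rfl⟩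
  | call =>
    have := A.tm.ΛFin
    exact .of_surjective (fun l : Option (Option A.tm.Λ) =>
      l.elim .load fun l => l.elim .unload .run) fun
        | .load => ⟨none, rfl⟩
        | .unload => ⟨some none, rfl⟩
        | .run l => ⟨some (some l), rfl⟩

/-- The label at which the compiled program starts. -/
def entry : (p : Prog) → Label A p
  | .skip => .skip
  | .push r a => .push r a
  | .pop r p => .pop r p
  | .seq p q => .seqLeft p q (entry p)
  | .loop r b p => .loop r b p
  | .call => .load

/-- Pop a symbol from a register and remember it. -/
def popReg {Λ : Type} (r : Reg) (q : CStmt A Λ) : CStmt A Λ :=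
  .pop (.reg r) (fun v a => (v.1, a)) q

/-- The compiled program as a part of a machine with labels `Λ`, where it continues at the label
`x` after its end. -/
def compile {Λ : Type} : (p : Prog) → (Label A p → Λ) → Λ → Label A p → CStmt A Λ
  | .skip, _, x, _ => .goto fun _ => x
  | .push r a, _, x, _ => .push (.reg r) (fun _ => a) (.goto fun _ => x)
  | .pop r p, ι, _, .pop _ _ =>
      popReg A r (.goto fun v => ι (.popIn r p v.2 (entry A (p v.2))))
  | .pop r p, ι, x, .popIn _ _ a l => compile (p a) (fun l => ι (.popIn r p a l)) x l
  | .seq p q, ι, _, .seqLeft _ _ l =>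
      compile p (fun l => ι (.seqLeft p q l)) (ι (.seqRight p q (entry A q))) l
  | .seq p q, ι, x, .seqRight _ _ l => compile q (fun l => ι (.seqRight p q l)) x l
  | .loop r b p, ι, x, .loop _ _ _ =>
      popReg A r (.goto fun v => if b v.2 then ι (.loopIn r b p v.2 (entry A (p v.2))) else x)
  | .loop r b p, ι, _, .loopIn _ _ _ a l =>
      compile (p a) (fun l => ι (.loopIn r b p a l)) (ι (.loop r b p)) l
  | .call, ι, _, .load =>
      popReg A .tmp (.branch (fun v => v.2.isSome)
        (.push (.sub A.tm.k₀)
          (fun v => A.inputAlphabet.symm ((v.2.getD none).getD .endMark)) (.goto fun _ => ι .load))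
        (.goto fun _ => ι (.run A.tm.main)))
  | .call, ι, _, .run l => liftStmt A (fun l => ι (.run l)) (ι .unload) (A.tm.m l)
  | .call, ι, x, .unload =>
      .pop (.sub A.tm.k₁) (fun v a => (v.1, a.map fun g => some (A.outputAlphabet g)))
        (.branch (fun v => v.2.isSome)
          (.push (.reg .tmp) (fun v => v.2.getD none) (.goto fun _ => ι .unload))
          (.goto fun _ => x))

/-- The answers of the oracle machine. -/
def Oracle.Answers (s s' : List Letter) (t : ℕ) : Prop :=
  ∃ n ≤ t, Steps A.tm.step n (initList A.tm (s.map A.inputAlphabet.symm))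
    (haltList A.tm (s'.map A.outputAlphabet.symm))

/-- The configuration in which the compiled program is at the label `l`. -/
def conf {Λ : Type} (l : Λ) (y : Option Sym) (i : List Letter) (o : List Bool) (S : Store) :
    TM2.Cfg (Stk.Γ A) Λ (St A) :=
  ⟨some l, (A.tm.initialState, y), contents A i o S fun _ => []⟩

theorem initList_eq (tm : FinTM2) (s : List (tm.Γ tm.k₀)) :
    initList tm s = ⟨some tm.main, tm.initialState, update (fun _ => []) tm.k₀ s⟩ := by
  unfold initList
  congr 1
  funext k
  by_cases h : k = tm.k₀
  · subst h; simp
  · simp [h]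

theorem haltList_eq (tm : FinTM2) (s : List (tm.Γ tm.k₁)) :
    haltList tm s = ⟨none, tm.initialState, update (fun _ => []) tm.k₁ s⟩ := by
  unfold haltList
  congr 1
  funext k
  by_cases h : k = tm.k₁
  · subst h; simp
  · simp [h]

variable {A}

theorem step_popReg {Λ : Type} {M : Λ → CStmt A Λ} {l : Λ} {r : Reg} {f : St A → Λ}
    (h : M l = popReg A r (.goto f)) (y i o S) :
    TM2.step M (conf A l y i o S) =
      some (conf A (f (A.tm.initialState, (S r).head?)) (S r).head? i o
        (update S r (S r).tail)) := by
  simp only [conf, TM2.step, h, popReg, TM2.stepAux, ← update_contents_reg]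
  rfl

/-- Popping from `tmp` and pushing on the input stack reverses the word, which is why `call` expects
it reversed in `tmp`. The part `z` already transferred is arbitrary for the sake of the induction.
-/
theorem steps_load {Λ : Type} {M : Λ → CStmt A Λ} {ι : Label A .call → Λ} {x : Λ}
    (hM : ∀ l, M (ι l) = compile A _ ι x l) (i o) (s : List Letter) (z) (S : Store) (y)
    (hS : S .tmp = s.map some) :
    ∃ y', Steps (TM2.step M) (s.length + 1)
      ⟨some (ι .load), (A.tm.initialState, y), contents A i o S (update (fun _ => []) A.tm.k₀ z)⟩
      ⟨some (ι (.run A.tm.main)), (A.tm.initialState, y'),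
        contents A i o (update S .tmp [])
          (update (fun _ => []) A.tm.k₀ ((s.map A.inputAlphabet.symm).reverse ++ z))⟩ := by
  induction s generalizing z S y with
  | nil =>
    refine ⟨none, Steps.single ?_⟩
    simp only [TM2.step, hM, compile, popReg, TM2.stepAux, update_contents_reg]
    have e : (contents A i o S (update (fun _ => []) A.tm.k₀ z) (.reg .tmp)) = [] := hS
    rw [e]
    simp
  | cons a s ih =>
    obtain ⟨y', h⟩ := ih (A.inputAlphabet.symm a :: z) (update S .tmp (s.map some)) (some (some a))
      (by simp)
    refine ⟨y', Steps.head ?_ (by simpa using h)⟩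
    simp only [TM2.step, hM, compile, popReg, TM2.stepAux, update_contents_reg]
    have e : (contents A i o S (update (fun _ => []) A.tm.k₀ z) (.reg .tmp)) =
      some a :: s.map some := hS
    rw [e]
    simp only [update_contents_sub]
    simp [contents]

/-- `Oracle.Answers` ends in the initial internal state with all stacks but the output empty.
Emptying the output therefore restores the form `conf`, and the oracle is ready for another call. -/
theorem steps_unload {Λ : Type} {M : Λ → CStmt A Λ} {ι : Label A .call → Λ} {x : Λ}
    (hM : ∀ l, M (ι l) = compile A _ ι x l) (i o) (s : List Letter) (S : Store) (y) :
    ∃ y', Steps (TM2.step M) (s.length + 1)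
      ⟨some (ι .unload), (A.tm.initialState, y), contents A i o S
        (update (fun _ => []) A.tm.k₁ (s.map A.outputAlphabet.symm))⟩
      (conf A x y' i o (update S .tmp (s.reverse.map some ++ S .tmp))) := by
  induction s generalizing S y with
  | nil =>
    refine ⟨none, Steps.single ?_⟩
    simp only [TM2.step, hM, compile, TM2.stepAux, update_contents_sub]
    have e : (contents A i o S (update (fun _ => []) A.tm.k₁
      (([] : List Letter).map A.outputAlphabet.symm)) (.sub A.tm.k₁)) = [] := by
      simp [contents]
    rw [e]
    simp [conf]
  | cons a s ih =>
    obtain ⟨y', h⟩ := ih (update S .tmp (some a :: S .tmp)) (some (some a))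
    refine ⟨y', Steps.head ?_ (by simpa using h)⟩
    simp only [TM2.step, hM, compile, TM2.stepAux, update_contents_sub]
    have e : (contents A i o S (update (fun _ => []) A.tm.k₁
      ((a :: s).map A.outputAlphabet.symm)) (.sub A.tm.k₁)) =
        A.outputAlphabet.symm a :: s.map A.outputAlphabet.symm := by
      simp [contents]
    rw [e]
    simp only [update_contents_reg]
    simp [contents]

/-- Correctness of the compiler. The machine `M`, the embedding `ι` of the labels and the exit `x`
are universally quantified, so that the induction applies to subprograms, whose exits differ. The
remembered symbol carries no information between instructions. -/
theorem Runs.steps {p S S' t} (h : Runs A.Answers p S S' t) :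
    ∀ {Λ : Type} {M : Λ → CStmt A Λ} {ι : Label A p → Λ} {x : Λ}
      (_ : ∀ l, M (ι l) = compile A _ ι x l) (y i o),
      ∃ n ≤ t, ∃ y', Steps (TM2.step M) n (conf A (ι (entry A p)) y i o S) (conf A x y' i o S') := by
  induction h with
  | skip S =>
    intro Λ M ι x hM y i o
    exact ⟨1, le_rfl, y, Steps.single (by simp only [conf, TM2.step, hM]; rfl)⟩
  | push r a S =>
    intro Λ M ι x hM y i o
    refine ⟨1, le_rfl, y, Steps.single ?_⟩
    simp only [conf, TM2.step, hM, compile, TM2.stepAux, ← update_contents_reg]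
    rfl
  | @pop r p S S' t h ih =>
    intro Λ M ι x hM y i o
    obtain ⟨n, hn, y', h⟩ := ih (M := M) (ι := fun l => ι (.popIn r p _ l)) (x := x)
      (fun l => hM (.popIn r p _ l)) (S r).head? i o
    exact ⟨n + 1, by omega, y', Steps.head (step_popReg (hM (.pop r p)) ..) h⟩
  | @seq p q S S' S'' t t' h h' ih ih' =>
    intro Λ M ι x hM y i o
    obtain ⟨n, hn, y', h⟩ := ih (M := M) (ι := fun l => ι (.seqLeft p q l)) (x := ι (.seqRight p q (entry A q)))
      (fun l => hM (.seqLeft p q l)) y i o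
    obtain ⟨n', hn', y'', h'⟩ := ih' (M := M) (ι := fun l => ι (.seqRight p q l)) (x := x)
      (fun l => hM (.seqRight p q l)) y' i o
    exact ⟨n + n', by omega, y'', h.trans h'⟩
  | @loop_exit r b p S h =>
    intro Λ M ι x hM y i o
    refine ⟨1, le_rfl, (S r).head?, Steps.single ?_⟩
    have := step_popReg (hM (.loop r b p)) y i o S
    simp only [h] at this
    exact this
  | @loop_next r b p S S' S'' t t' h h₁ h₂ ih ih' =>
    intro Λ M ι x hM y i o
    obtain ⟨n, hn, y', h'⟩ := ih (M := M) (ι := fun l => ι (.loopIn r b p _ l))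
      (x := ι (.loop r b p)) (fun l => hM (.loopIn r b p _ l)) (S r).head? i o
    obtain ⟨n', hn', y'', h''⟩ := ih' hM y' i o
    refine ⟨n + n' + 1, by omega, y'', Steps.head ?_ (h'.trans h'')⟩
    have := step_popReg (hM (.loop r b p)) y i o S
    simp only [h, if_true] at this
    exact this
  | @call S s s' t h h' =>
    intro Λ M ι x hM y i o
    obtain ⟨n, hn, h'⟩ := h'
    obtain ⟨y₁, h₁⟩ := steps_load hM i o s.reverse [] S y h
    rw [initList_eq, haltList_eq] at h'
    have h₂ := Steps.lift A (fun l => ι (.run l)) (ι .unload) y₁ i o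
      (update S .tmp []) M (fun l => hM (.run l)) h'
    obtain ⟨y₃, h₃⟩ := steps_unload hM i o s' (update S .tmp []) y₁
    -- Loading and unloading take one step per symbol and one more to find the stack empty; this is
    -- the `+ 2` in the cost of `call`.
    refine ⟨s.reverse.length + 1 + n + (s'.length + 1), by simp; omega, y₃, ?_⟩
    refine (Steps.trans ?_ h₂).trans ?_
    · convert h₁ using 1
      · simp [conf, entry]
      · simp [liftCfg]
    · convert h₃ using 1
      · rfl
      · simp
  | mono h h' ih =>
    intro Λ M ι x hM y i o
    obtain ⟨n, hn, y', h⟩ := ih hM y i o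
    exact ⟨n, by omega, y', h⟩

variable (A)

/-- The machine that loads the input into the register `tmp`, runs a program and returns the boolean
in the register `main`. -/
def mainStmt (p : Prog) : Option (Option (Label A p)) → CStmt A (Option (Option (Label A p)))
  | none => .pop .inp (fun v a => (v.1, a.map some)) (.branch (fun v => v.2.isSome)
      (.push (.reg .tmp) (fun v => v.2.getD none) (.goto fun _ => none))
      (.goto fun _ => some (some (entry A p))))
  | some none => popReg A .main (.push .out (fun v => decide (v.2 = some (some (.bit true))))
      (.load (fun _ => (A.tm.initialState, none)) .halt))
  | some (some l) => compile A p (fun l => some (some l)) (some none) l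

/-- The machine that loads the input into the register `tmp`, runs a program and returns the boolean
in the register `main`. -/
noncomputable def mainMachine (p : Prog) : FinTM2 :=
  have := A.tm.kFin
  have := A.tm.σFin
  have := Label.finite A p
  { K := Stk A.tm.K
    kFin := Fintype.ofFinite _
    k₀ := .inp
    k₁ := .out
    Γ := Stk.Γ A
    Λ := Option (Option (Label A p))
    main := none
    ΛFin := Fintype.ofFinite _
    σ := St A
    initialState := (A.tm.initialState, none)
    Γk₀Fin := inferInstanceAs (Fintype Letter)
    m := mainStmt A p }

variable {A}

theorem steps_input (p : Prog) (s S y) :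
    ∃ y', Steps (TM2.step (mainStmt A p)) (s.length + 1) (conf A none y s [] S)
      (conf A (some (some (entry A p))) y' [] [] (update S .tmp (s.reverse.map some ++ S .tmp))) := by
  induction s generalizing S y with
  | nil =>
    refine ⟨none, Steps.single ?_⟩
    simp only [conf, TM2.step, mainStmt, TM2.stepAux, update_contents_inp]
    simp [contents]
  | cons a s ih =>
    obtain ⟨y', h⟩ := ih (update S .tmp (some a :: S .tmp)) (some (some a))
    refine ⟨y', Steps.head ?_ (by simpa using h)⟩
    simp only [conf, TM2.step, mainStmt, TM2.stepAux, update_contents_inp]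
    simp only [update_contents_reg]
    simp [contents]

theorem step_output (p : Prog) (b : Bool) (y) :
    TM2.step (mainStmt A p)
      (conf A (some none) y [] [] (update (fun _ => []) .main [some (.bit b)])) =
      some ⟨none, (A.tm.initialState, none), contents A [] [b] (fun _ => []) fun _ => []⟩ := by
  simp only [conf, TM2.step, mainStmt, popReg, TM2.stepAux, update_contents_reg,
    update_contents_out]
  cases b <;> simp [contents]

/-- A function is computable in polynomial time if it is computed by a stack program in polynomial
time. -/
theorem polyTime_of_runs {α : Type} {e : α → List Letter} {f : α → Bool} (p : Prog)
    (q : Polynomial ℕ)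
    (h : ∀ x, Runs A.Answers p (update (fun _ => []) .tmp ((e x).reverse.map some))
      (update (fun _ => []) .main [some (.bit (f x))]) (q.eval (e x).length)) :
    Nonempty (TM2ComputableInPolyTime e Computability.encodeBool f) := by
  refine ⟨⟨⟨mainMachine A p, Equiv.refl _, Equiv.refl _⟩, Polynomial.X + q + 2, fun x => ?_⟩⟩
  -- Reading the input takes `(e x).length + 1` steps, the program at most `q`, and writing the
  -- answer one.
  suffices hs : ∃ n ≤ (Polynomial.X + q + 2 : Polynomial ℕ).eval (e x).length,
      Steps (TM2.step (mainStmt A p)) n (conf A none none (e x) [] fun _ => [])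
        ⟨none, (A.tm.initialState, none), contents A [] [f x] (fun _ => []) fun _ => []⟩ by
    apply Classical.choice
    obtain ⟨n, hn, hs⟩ := hs
    refine ⟨⟨⟨n, ?_⟩, hn⟩⟩
    rw [initList_eq, Option.map_some, haltList_eq]
    have e₁ : update (fun _ => []) (mainMachine A p).k₀
        ((e x).map (Equiv.refl ((mainMachine A p).Γ (mainMachine A p).k₀)).invFun) =
        contents A (e x) [] (fun _ => []) fun _ => [] := by
      rw [← update_contents_inp [], contents_nil]
      exact congrArg (update (fun _ => []) Stk.inp) (List.map_id (e x))
    have e₂ : update (fun _ => []) (mainMachine A p).k₁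
        ((Computability.encodeBool (f x)).map
          (Equiv.refl ((mainMachine A p).Γ (mainMachine A p).k₁)).invFun) =
        contents A [] [f x] (fun _ => []) fun _ => [] := by
      rw [← update_contents_out [] [], contents_nil]
      rfl
    erw [e₁, e₂]
    exact hs
  obtain ⟨y₁, h₁⟩ := steps_input (A := A) p (e x) (fun _ => []) none
  obtain ⟨n, hn, y₂, h₂⟩ := (h x).steps (M := mainStmt A p) (ι := fun l => some (some l))
    (x := some none) (fun l => rfl) y₁ [] []
  refine ⟨(e x).length + 1 + (n + 1), ?_, Steps.trans (by simpa using h₁)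
    (h₂.trans (Steps.single (step_output p (f x) y₂)))⟩
  simp only [Polynomial.eval_add, Polynomial.eval_X, Polynomial.eval_ofNat]
  omega

end Compile
end Syllogistic

namespace Syllogistic
open Function

/-! ### Basic stack programs -/

section BasicPrograms

/-- The store with the given contents of the registers. -/
def st (m a t u c : List Sym) : Store
  | .main => m
  | .aux => a
  | .tmp => t
  | .tmp' => u
  | .cnt => c

section
variable (m a t u c x : List Sym)

@[simp] theorem st_main : st m a t u c .main = m := rfl
@[simp] theorem st_aux : st m a t u c .aux = a := rfl
@[simp] theorem st_tmp : st m a t u c .tmp = t := rfl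
@[simp] theorem st_tmp' : st m a t u c .tmp' = u := rfl
@[simp] theorem st_cnt : st m a t u c .cnt = c := rfl
@[simp] theorem update_st_main : update (st m a t u c) .main x = st x a t u c := by
  funext r; cases r <;> rfl
@[simp] theorem update_st_aux : update (st m a t u c) .aux x = st m x t u c := by
  funext r; cases r <;> rfl
@[simp] theorem update_st_tmp : update (st m a t u c) .tmp x = st m a x u c := by
  funext r; cases r <;> rfl
@[simp] theorem update_st_tmp' : update (st m a t u c) .tmp' x = st m a t x c := by
  funext r; cases r <;> rfl
@[simp] theorem update_st_cnt : update (st m a t u c) .cnt x = st m a t u x := by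
  funext r; cases r <;> rfl

end

variable {O : List Letter → List Letter → ℕ → Prop}

theorem Runs.congr {p : Prog} {S S' S'' : Store} {t t' : ℕ} (h : Runs O p S S' t) (e : S' = S'')
    (h' : t ≤ t') : Runs O p S S'' t' := by
  subst e; exact h.mono h'

theorem Runs.congr' {p : Prog} {S₀ S S' S'' : Store} {t t' : ℕ} (h : Runs O p S S' t)
    (e₀ : S = S₀) (e : S' = S'') (h' : t ≤ t') : Runs O p S₀ S'' t' := by
  subst e₀; exact h.congr e h'

/-- The loop that moves trees from the register `i` to the register `j`, as many as there are
symbols in the register `cnt`. -/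
def takeLoop (i j : Reg) : Prog :=
  .loop .cnt Option.isSome fun _ => .pop i fun
    | none => .skip
    | some a => .seq (.push j a)
        (if a.isSome then .skip else .seq (.push .cnt none) (.push .cnt none))

/-- Move a tree from the register `i` to the register `j`, with its code reversed. -/
def take (i j : Reg) : Prog := .seq (.push .cnt none) (takeLoop i j)

/-- Empty the register `i` into the register `j`. -/
def pour (i j : Reg) : Prog :=
  .loop i Option.isSome fun
    | none => .skip
    | some a => .push j a

/-- Empty the register `i` into both `j` and `k`. -/
def pour₂ (i j k : Reg) : Prog :=
  .loop i Option.isSome fun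
    | none => .skip
    | some a => .seq (.push j a) (.push k a)

/-- Empty the register `i`. -/
def clear (i : Reg) : Prog := .loop i Option.isSome fun _ => .skip

/-- Push a word on the register `i`. -/
def pushAll (i : Reg) : List Sym → Prog
  | [] => .skip
  | a :: l => .seq (pushAll i l) (.push i a)

/-- The register `cnt` holds one symbol for each tree still to be read: a leaf uses one up, a node
replaces one by two. The rest of the run is a hypothesis, so that the two subtrees of a node can be
chained; at most five units are spent per symbol. -/
theorem runs_takeLoop {i j : Reg} (hij : i ≠ j) (hi : i ≠ .cnt) (hj : j ≠ .cnt) (x : Tree)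
    {S S' : Store} {R C : List Sym} {t : ℕ} (hSi : S i = x.code ++ R) (hS : S .cnt = none :: C)
    (h : Runs O (takeLoop i j)
      (update (update (update S i R) j (x.code.reverse ++ S j)) .cnt C) S' t) :
    Runs O (takeLoop i j) S S' (5 * x.size + t) := by
  induction x generalizing S R C t with
  | leaf a =>
    refine Runs.mono (Runs.loop_next (t := 3) (by simp [hS]) (Runs.pop ?_) h)
      (by rw [Tree.size_leaf]; omega)
    have e : (update S .cnt (S .cnt).tail i) = some a :: R := by simp [hi, hSi]
    rw [e]
    refine (Runs.seq (Runs.push ..) (Runs.skip _)).congr ?_ le_rfl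
    funext r
    simp only [update_apply, hS]
    split_ifs <;> simp_all
  | node l r ihl ihr =>
    have e : (update S .cnt (S .cnt).tail i) = none :: (l.code ++ (r.code ++ R)) := by
      simp [hi, hSi]
    have h' : Runs O (takeLoop i j)
        (update (update (update S i (l.code ++ (r.code ++ R))) j (none :: S j)) .cnt
          (none :: none :: C)) S' (5 * l.size + (5 * r.size + t)) := by
      refine ihl (R := r.code ++ R) (C := none :: C) (by simp [hij, hi]) (by simp) ?_
      refine ihr (R := R) (C := C) (by simp [hij, hi]) (by simp) ?_
      convert h using 1
      funext r
      simp only [update_apply]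
      split_ifs <;> simp_all
    refine Runs.mono (Runs.loop_next (t := 4) (by simp [hS]) (Runs.pop ?_) h')
      (by simp; omega)
    rw [e]
    refine (Runs.seq (Runs.push ..) (Runs.seq (Runs.push ..) (Runs.push ..))).congr ?_ le_rfl
    funext r
    simp only [update_apply, hS]
    split_ifs <;> simp_all

theorem runs_take {i j : Reg} (hij : i ≠ j) (hi : i ≠ .cnt) (hj : j ≠ .cnt) (x : Tree)
    {S : Store} {R : List Sym} (hSi : S i = x.code ++ R) (hS : S .cnt = []) :
    Runs O (take i j) S (update (update S i R) j (x.code.reverse ++ S j)) (5 * x.size + 2) := by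
  refine (Runs.seq (Runs.push ..) (runs_takeLoop (R := R) (C := []) hij hi hj x (by simp [hi, hSi])
    (by simp [hS]) (Runs.loop_exit (by simp)))).congr ?_ (by omega)
  funext r
  simp only [update_apply]
  split_ifs <;> simp_all

theorem runs_pour {i j : Reg} (hij : i ≠ j) (S : Store) :
    Runs O (pour i j) S (update (update S i []) j ((S i).reverse ++ S j)) (2 * (S i).length + 1) := by
  generalize hl : S i = l
  induction l generalizing S with
  | nil =>
    refine (Runs.loop_exit (by simp [hl])).congr ?_ (by simp)
    funext r
    simp only [update_apply]
    split_ifs <;> simp_all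
  | cons a l ih =>
    refine (Runs.loop_next (by simp [hl]) ?_ (ih (update (update S i l) j (a :: S j))
      (by simp [hij]))).congr ?_ (t := 1 + (2 * l.length + 1) + 1) (by simp; omega)
    · rw [hl]
      refine (Runs.push ..).congr ?_ le_rfl
      simp [hij.symm]
    · funext r
      simp only [update_apply]
      split_ifs <;> simp_all

theorem runs_pour₂ {i j k : Reg} (hij : i ≠ j) (hik : i ≠ k) (hjk : j ≠ k) (S : Store) :
    Runs O (pour₂ i j k) S (update (update (update S i []) j ((S i).reverse ++ S j)) k
      ((S i).reverse ++ S k)) (3 * (S i).length + 1) := by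
  generalize hl : S i = l
  induction l generalizing S with
  | nil =>
    refine (Runs.loop_exit (by simp [hl])).congr ?_ (by simp)
    funext r
    simp only [update_apply]
    split_ifs <;> simp_all
  | cons a l ih =>
    refine (Runs.loop_next (by simp [hl]) ?_ (ih (update (update (update S i l) j (a :: S j)) k
      (a :: S k)) (by simp [hij, hik]))).congr ?_ (t := 2 + (3 * l.length + 1) + 1) (by simp; omega)
    · rw [hl]
      refine (Runs.seq (Runs.push ..) (Runs.push ..)).congr ?_ le_rfl
      simp [hij.symm, hik.symm, hjk.symm]
    · funext r
      simp only [update_apply]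
      split_ifs <;> simp_all

theorem runs_clear (i : Reg) (S : Store) :
    Runs O (clear i) S (update S i []) (2 * (S i).length + 1) := by
  generalize hl : S i = l
  induction l generalizing S with
  | nil => exact (Runs.loop_exit (by simp [hl])).congr (by simp [hl]) (by simp)
  | cons a l ih =>
    refine (Runs.loop_next (by simp [hl]) (Runs.skip _) (ih (update S i (S i).tail)
      (by simp [hl]))).congr (by simp) (by simp; omega)

theorem runs_pushAll (i : Reg) (l : List Sym) (S : Store) :
    Runs O (pushAll i l) S (update S i (l ++ S i)) (l.length + 1) := by
  induction l with
  | nil => exact (Runs.skip _).congr (by simp) (by simp)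
  | cons a l ih => exact (ih.seq (Runs.push ..)).congr (by simp) (by simp)

end BasicPrograms

/-! ### Functions that are computed by stack programs in polynomial time -/

theorem eval_mono (q : Polynomial ℕ) {m n : ℕ} (h : m ≤ n) : q.eval m ≤ q.eval n := by
  rw [Polynomial.eval_eq_sum, Polynomial.eval_eq_sum]
  exact Finset.sum_le_sum fun i _ => Nat.mul_le_mul_left _ (Nat.pow_le_pow_left h i)

/-- Types whose elements are represented by trees. -/
class TEnc (α : Type) where
  toTree : α → Tree

/-- The tree that represents an element of a type. -/
def enc {α : Type} [TEnc α] (x : α) : Tree := TEnc.toTree x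

/-- The size of the tree that represents an element of a type. -/
def esize {α : Type} [TEnc α] (x : α) : ℕ := (enc x).size

instance : TEnc Tree := ⟨id⟩
instance : TEnc Letter := ⟨Tree.leaf⟩
instance : TEnc Bool := ⟨fun b => .leaf (.bit b)⟩
instance {α β : Type} [TEnc α] [TEnc β] : TEnc (α × β) := ⟨fun x => .node (enc x.1) (enc x.2)⟩

/-- The tree that represents the empty list. -/
def Tree.nil : Tree := .leaf .endMark

/-- Lists are represented by right combs. -/
def encList {α : Type} [TEnc α] : List α → Tree
  | [] => .nil
  | x :: l => .node (enc x) (encList l)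

instance {α : Type} [TEnc α] : TEnc (List α) := ⟨encList⟩

section Enc
variable {α β : Type} [TEnc α] [TEnc β]

@[simp] theorem enc_tree (x : Tree) : enc x = x := rfl
@[simp] theorem enc_letter (a : Letter) : enc a = .leaf a := rfl
@[simp] theorem enc_bool (b : Bool) : enc b = .leaf (.bit b) := rfl
@[simp] theorem enc_prod (x : α) (y : β) : enc (x, y) = .node (enc x) (enc y) := rfl
@[simp] theorem enc_nil : enc ([] : List α) = .nil := rfl
@[simp] theorem enc_cons (x : α) (l : List α) : enc (x :: l) = .node (enc x) (enc l) := rfl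
@[simp] theorem esize_tree (x : Tree) : esize x = x.size := rfl
@[simp] theorem esize_letter (a : Letter) : esize a = 1 := rfl
@[simp] theorem esize_bool (b : Bool) : esize b = 1 := rfl
@[simp] theorem esize_prod (x : α) (y : β) : esize (x, y) = esize x + esize y + 1 :=
  Tree.size_node ..
@[simp] theorem esize_nil : esize ([] : List α) = 1 := rfl
@[simp] theorem esize_cons (x : α) (l : List α) : esize (x :: l) = esize x + esize l + 1 :=
  Tree.size_node ..
theorem length_code_enc (x : α) : (enc x).code.length = esize x := rfl

end Enc

/-- `PT O f`: a stack program with the oracle `O` computes `f` in polynomial time. -/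
def PT (O : List Letter → List Letter → ℕ → Prop) {α β : Type} [TEnc α] [TEnc β] (f : α → β) :
    Prop :=
  ∃ (p : Prog) (q : Polynomial ℕ), ∀ x m a, Runs O p (st ((enc x).code ++ m) a [] [] [])
    (st ((enc (f x)).code ++ m) a [] [] []) (q.eval (esize x))

namespace PT

variable {O : List Letter → List Letter → ℕ → Prop} {α β γ δ : Type} [TEnc α] [TEnc β] [TEnc γ]
  [TEnc δ]

/-- A program has no time to write a larger result. -/
theorem esize_le {f : α → β} (h : PT O f) :
    ∃ q : Polynomial ℕ, ∀ x, esize (f x) ≤ q.eval (esize x) := by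
  obtain ⟨p, q, h⟩ := h
  refine ⟨Polynomial.X + q, fun x => ?_⟩
  have := (h x [] []).length_le .main
  simpa [length_code_enc] using this

/-- Only the trees matter, so a function may be exchanged for one with another codomain whenever the
codes of the values agree. -/
theorem of_enc {f : α → β} {g : α → γ} (hg : PT O g) (h : ∀ x, enc (f x) = enc (g x)) :
    PT O f := by
  obtain ⟨p, q, hg⟩ := hg
  exact ⟨p, q, fun x m a => by rw [h]; exact hg x m a⟩

theorem of_enc_enc {f : α → β} {g : γ → δ} (hg : PT O g) (k : α → γ) (hk : ∀ x, enc (k x) = enc x)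
    (h : ∀ x, enc (f x) = enc (g (k x))) : PT O f := by
  obtain ⟨p, q, hg⟩ := hg
  refine ⟨p, q, fun x m a => ?_⟩
  have := hg (k x) m a
  rwa [← h, hk, esize, hk] at this

theorem id : PT O (fun x : α => x) := ⟨.skip, 1, fun x m a => by simpa using Runs.skip _⟩

/-- The intermediate result has size at most `q₀`, hence the time `q₂.comp q₀` for the second
program. -/
theorem comp {g : β → γ} {f : α → β} (hg : PT O g) (hf : PT O f) : PT O (fun x => g (f x)) := by
  obtain ⟨q₀, h₀⟩ := hf.esize_le
  obtain ⟨p₁, q₁, hf⟩ := hf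
  obtain ⟨p₂, q₂, hg⟩ := hg
  refine ⟨.seq p₁ p₂, q₁ + q₂.comp q₀, fun x m a => ((hf x m a).seq (hg (f x) m a)).mono ?_⟩
  have := eval_mono q₂ (h₀ x)
  simp only [Polynomial.eval_add, Polynomial.eval_comp]
  omega

theorem const (y : β) : PT O (fun _ : α => y) := by
  refine ⟨.seq (take .main .tmp) (.seq (clear .tmp) (pushAll .main (enc y).code)),
    7 * Polynomial.X + Polynomial.C (esize y + 4), fun x m a => ?_⟩
  refine ((runs_take (R := m) (by decide) (by decide) (by decide) (enc x) rfl rfl).seq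
    ((runs_clear ..).seq (runs_pushAll ..))).congr (by simp) ?_
  simp [length_code_enc, esize]
  simp [Tree.size]
  omega

/-- The argument is copied to `main` and `aux`. `g` runs first, while the copy waits in `aux`, so
that the value of `f` ends up on top of that of `g`; the last push adds the node marker. -/
theorem pair {f : α → β} {g : α → γ} (hf : PT O f) (hg : PT O g) : PT O (fun x => (f x, g x)) := by
  obtain ⟨p₁, q₁, hf⟩ := hf
  obtain ⟨p₂, q₂, hg⟩ := hg
  refine ⟨.seq (take .main .tmp) (.seq (pour₂ .tmp .main .aux) (.seq p₂ (.seq (take .aux .tmp)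
    (.seq (pour .tmp .main) (.seq p₁ (.push .main none)))))), 15 * Polynomial.X + q₁ + q₂ + 7,
    fun x m a => ?_⟩
  have h₁ := runs_take (O := O) (i := .main) (j := .tmp) (by decide) (by decide) (by decide) (enc x)
    (S := st ((enc x).code ++ m) a [] [] []) rfl rfl
  have h₂ := runs_pour₂ (O := O) (i := .tmp) (j := .main) (k := .aux) (by decide) (by decide)
    (by decide) (st m a (enc x).code.reverse [] [])
  have h₃ := runs_take (O := O) (i := .aux) (j := .tmp) (by decide) (by decide) (by decide) (enc x)
    (S := st ((enc (g x)).code ++ m) ((enc x).code ++ a) [] [] []) rfl rfl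
  have h₄ := runs_pour (O := O) (i := .tmp) (j := .main) (by decide)
    (st ((enc (g x)).code ++ m) a (enc x).code.reverse [] [])
  simp at h₁ h₂ h₃ h₄
  refine (h₁.seq (h₂.seq ((hg x _ _).seq (h₃.seq (h₄.seq ((hf x _ _).seq
    (Runs.push ..))))))).congr (by simp) ?_
  simp [esize, Tree.size]
  omega

end PT

end Syllogistic

/-! ### Polynomial-time operations on trees: projections, case distinction, equality -/

namespace Syllogistic
open Function

namespace Tree

/-- The left subtree of a node; a leaf is returned unchanged. -/
def left : Tree → Tree
  | leaf a => leaf a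
  | node l _ => l

/-- The right subtree of a node; a leaf is returned unchanged. -/
def right : Tree → Tree
  | leaf a => leaf a
  | node _ r => r

/-- The label of the root. -/
def root : Tree → Sym
  | leaf a => some a
  | node _ _ => none

end Tree

/-- A program moves the tree on top of `main` to `aux`. -/
def toAux : Prog := .seq (take .main .tmp) (pour .tmp .aux)

/-- A program moves the tree on top of `aux` to `main`. -/
def toMain : Prog := .seq (take .aux .tmp) (pour .tmp .main)

/-- A program removes the tree on top of `main`. -/
def drop : Prog := .seq (take .main .tmp) (clear .tmp)

section
variable {O : List Letter → List Letter → ℕ → Prop}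

theorem runs_toAux (x : Tree) (m a : List Sym) :
    Runs O toAux (st (x.code ++ m) a [] [] []) (st m (x.code ++ a) [] [] []) (7 * x.size + 3) := by
  refine ((runs_take (R := m) (by decide) (by decide) (by decide) x rfl rfl).seq
    (runs_pour (by decide) _)).congr (by simp) ?_
  simp [Tree.size]
  omega

theorem runs_toMain (x : Tree) (m a : List Sym) :
    Runs O toMain (st m (x.code ++ a) [] [] []) (st (x.code ++ m) a [] [] []) (7 * x.size + 3) := by
  refine ((runs_take (R := a) (by decide) (by decide) (by decide) x rfl rfl).seq
    (runs_pour (by decide) _)).congr (by simp) ?_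
  simp [Tree.size]
  omega

theorem runs_drop (x : Tree) (m a : List Sym) :
    Runs O drop (st (x.code ++ m) a [] [] []) (st m a [] [] []) (7 * x.size + 3) := by
  refine ((runs_take (R := m) (by decide) (by decide) (by decide) x rfl rfl).seq
    (runs_clear _ _)).congr (by simp) ?_
  simp [Tree.size]
  omega

namespace PT
variable {α β γ δ : Type} [TEnc α] [TEnc β] [TEnc γ] [TEnc δ]

theorem treeRight : PT O Tree.right := by
  refine ⟨.pop .main fun
    | some (some b) => .push .main (some b)
    | _ => drop, 7 * Polynomial.X + 4, fun x m a =>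
    .mono (.pop (t := 7 * x.size + 3) ?_) (by simp)⟩
  cases x with
  | leaf b => exact (Runs.push ..).congr (by simp [Tree.right]) (by simp)
  | node l r => exact (runs_drop l (r.code ++ m) a).congr' (by simp) rfl (by simp; omega)

theorem treeLeft : PT O Tree.left := by
  refine ⟨.pop .main fun
    | some (some b) => .push .main (some b)
    | _ => .seq toAux (.seq drop toMain), 21 * Polynomial.X + 10,
    fun x m a => .mono (.pop (t := 21 * x.size + 9) ?_) (by simp)⟩
  cases x with
  | leaf b => exact (Runs.push ..).congr (by simp [Tree.left]) (by simp)
  | node l r =>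
    exact ((runs_toAux l (r.code ++ m) a).seq ((runs_drop r m _).seq (runs_toMain l m a))).congr'
      (by simp) rfl (by simp; omega)

theorem treeRoot (h : Sym → Letter) : PT O (fun x => h (Tree.root x)) := by
  -- The popped symbol is pushed back so that `drop` finds a complete code. Codes are nonempty, so
  -- the default `none` is never used for a missing symbol.
  refine ⟨.pop .main fun a => .seq (.push .main (a.getD none)) (.seq drop
    (.push .main (some (h (a.getD none))))), 7 * Polynomial.X + 6,
    fun x m a => .mono (.pop (t := 7 * x.size + 5) ?_) (by simp)⟩
  have hx : (x.code ++ m).head? = some x.root := by cases x <;> rfl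
  have hx' : x.root :: (x.code ++ m).tail = x.code ++ m := by cases x <;> rfl
  simp only [enc_tree, st_main, hx]
  refine ((Runs.push ..).seq ((?_ : Runs O drop _ (st m a [] [] []) _).seq
    (Runs.push ..))).congr (by simp) ?_ (t := 1 + (7 * x.size + 3 + 1))
  · simpa [hx'] using runs_drop x m a
  · omega

theorem fst {f : α → β × γ} (hf : PT O f) : PT O (fun x => (f x).1) :=
  (of_enc_enc treeLeft enc (fun _ => rfl) (f := Prod.fst) fun _ => rfl).comp hf

theorem snd {f : α → β × γ} (hf : PT O f) : PT O (fun x => (f x).2) :=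
  (of_enc_enc treeRight enc (fun _ => rfl) (f := Prod.snd) fun _ => rfl).comp hf

theorem comp₂ {h : β × γ → δ} (hh : PT O h) {f : α → β} {g : α → γ} (hf : PT O f) (hg : PT O g) :
    PT O (fun x => h (f x, g x)) :=
  hh.comp (hf.pair hg)

/-- The code of the pair `(c x, x)` starts with the node marker and the letter; popping both leaves
`x` and selects one of finitely many programs. The sum of their bounds serves for all of them. -/
theorem switch {c : α → Letter} (hc : PT O c) {g : Letter → α → β} (hg : ∀ b, PT O (g b)) :
    PT O (fun x => g (c x) x) := by
  obtain ⟨p, q, hp⟩ := hc.pair (PT.id (O := O) (α := α))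
  choose p' q' hp' using hg
  refine ⟨.seq p (.pop .main fun _ => .pop .main fun a => p' ((a.getD none).getD .endMark)),
    q + ∑ b, q' b + 2, fun x m a => ((hp x m a).seq (.pop (.pop ?_ (t := (q' (c x)).eval (esize x))))).mono ?_⟩
  · simpa using hp' (c x) x m a
  · have : (q' (c x)).eval (esize x) ≤ ∑ b, (q' b).eval (esize x) :=
      Finset.single_le_sum (f := fun b => (q' b).eval (esize x)) (fun _ _ => Nat.zero_le _)
        (Finset.mem_univ (c x))
    simp [Polynomial.eval_finsetSum]
    omega

theorem ite {c : α → Bool} (hc : PT O c) {f g : α → β} (hf : PT O f) (hg : PT O g) :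
    PT O (fun x => if c x then f x else g x) := by
  refine (switch (c := fun x => .bit (c x)) (hc.of_enc fun _ => rfl)
    (g := fun b => if b = .bit true then f else g) fun b => ?_).of_enc fun x => ?_
  · split_ifs <;> assumption
  · cases c x <;> simp

/-- The program compares the words in `tmp` and `tmp'`. -/
def cmpProg : Prog :=
  .seq (.loop .tmp Option.isSome fun a => .pop .tmp' fun b =>
    if a = b then .skip else .push .cnt none) (.seq
  (.loop .tmp' Option.isSome fun _ => .push .cnt none) (.pop .cnt fun
    | none => .push .main (some (.bit true))
    | some _ => .seq (clear .cnt) (.push .main (some (.bit false)))))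

/-- Every mismatch leaves a symbol in `cnt`, and an exhausted `l'` counts as a mismatch. Hence `cnt`
stays empty only if `l` is a prefix of `l'`. -/
theorem runs_cmp₁ (l l' m a C : List Sym) :
    ∃ C' : List Sym, (C' = [] ↔ C = [] ∧ l <+: l') ∧ C'.length ≤ C.length + l.length ∧
    Runs O (.loop .tmp Option.isSome fun a => .pop .tmp' fun b =>
      if a = b then .skip else .push .cnt none) (st m a l l' C) (st m a [] (l'.drop l.length) C')
        (3 * l.length + 1) := by
  induction l generalizing l' C with
  | nil => exact ⟨C, by simp, by simp, (Runs.loop_exit rfl).congr (by simp) (by simp)⟩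
  | cons b l ih =>
    by_cases h : l'.head? = some b
    · obtain ⟨l', rfl⟩ : ∃ l'', l' = b :: l'' := by
        cases l' <;> simp_all
      obtain ⟨C', h₁, h₂, h₃⟩ := ih l' C
      refine ⟨C', by simpa [List.cons_prefix_cons] using h₁, by simp; omega, ?_⟩
      refine (Runs.loop_next (by simp) (Runs.pop (t := 1) ?_) h₃).mono (by simp; omega)
      simp only [st_tmp', List.head?_cons, st_tmp, update_st_tmp, update_st_tmp', List.tail_cons,
        if_true]
      exact Runs.skip _
    · obtain ⟨C', h₁, h₂, h₃⟩ := ih l'.tail (none :: C)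
      refine ⟨C', ?_, by simp at h₂ ⊢; omega, ?_⟩
      · simp only [h₁, reduceCtorEq, false_and, false_iff, not_and]
        rintro - ⟨k, rfl⟩
        simp at h
      refine ((Runs.loop_next (by simp) (Runs.pop (t := 1) ?_) h₃).congr ?_ (by simp; omega))
      · have : ¬ some b = l'.head? := fun e => h e.symm
        simpa [this] using Runs.push (O := O) .cnt none (st m a l l'.tail C)
      · simp

theorem runs_cmp₂ (l m a C : List Sym) :
    Runs O (.loop .tmp' Option.isSome fun _ => .push .cnt none) (st m a [] l C)
      (st m a [] [] (List.replicate l.length none ++ C)) (2 * l.length + 1) := by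
  induction l generalizing C with
  | nil => exact (Runs.loop_exit rfl).congr (by simp) (by simp)
  | cons b l ih =>
    refine (Runs.loop_next (by simp) (Runs.push ..) (by simpa using ih (none :: C))).congr ?_
      (by simp; omega)
    rw [List.length_cons, List.replicate_succ']
    simp

/-- The first loop tests whether `l` is a prefix of `l'`, the second records every surplus symbol of
`l'`; the words are equal when neither leaves a trace in `cnt`. -/
theorem runs_cmp (l l' m a : List Sym) :
    Runs O cmpProg (st m a l l' []) (st (some (.bit (decide (l = l'))) :: m) a [] [] [])
      (5 * l.length + 4 * l'.length + 10) := by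
  obtain ⟨C, h₁, h₂, h₃⟩ := runs_cmp₁ (O := O) l l' m a []
  have h₄ := runs_cmp₂ (O := O) (l'.drop l.length) m a C
  have hC : (List.replicate (l'.drop l.length).length (none : Sym) ++ C = []) ↔ l = l' := by
    simp only [List.append_eq_nil_iff, h₁, List.replicate_eq_nil_iff, List.length_eq_zero_iff,
      List.drop_eq_nil_iff, true_and]
    exact ⟨fun h => h.2.eq_of_length_le h.1, fun h => by simp [h]⟩
  have hlen : (List.replicate (l'.drop l.length).length (none : Sym) ++ C).length ≤
      l'.length + l.length := by simp at *; omega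
  have hd : (l'.drop l.length).length ≤ l'.length := by simp
  generalize List.replicate (l'.drop l.length).length (none : Sym) ++ C = D at *
  by_cases h : l = l'
  · obtain rfl := hC.2 h
    refine (h₃.seq (h₄.seq (.pop (by
      simpa using Runs.push (O := O) .main (some (.bit true)) (st m a [] [] []))))).congr (by simp [h]) ?_
    omega
  · cases D with
    | nil => exact absurd (hC.1 rfl) h
    | cons b D =>
      refine (h₃.seq (h₄.seq (.pop ((runs_clear ..).seq (Runs.push ..))))).congr (by simp [h]) ?_
      simp at hlen ⊢
      omega

theorem treeEq : PT O (fun x : Tree × Tree => decide (x.1 = x.2)) := by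
  refine ⟨.pop .main fun _ => .seq (take .main .tmp) (.seq (take .main .tmp') cmpProg),
    19 * Polynomial.X + 20, fun x m a =>
      .mono (.pop (t := 19 * esize x + 19) ?_) (by simp)⟩
  obtain ⟨x, y⟩ := x
  have h₁ := runs_take (O := O) (i := .main) (j := .tmp) (by decide) (by decide) (by decide) x
    (S := st (x.code ++ (y.code ++ m)) a [] [] []) rfl rfl
  have h₂ := runs_take (O := O) (i := .main) (j := .tmp') (by decide) (by decide) (by decide) y
    (S := st (y.code ++ m) a x.code.reverse [] []) rfl rfl
  have h₃ := runs_cmp (O := O) x.code.reverse y.code.reverse m a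
  simp [Tree.code_injective.eq_iff] at h₁ h₂ h₃
  simp
  refine (h₁.seq (h₂.seq h₃)).mono ?_
  simp [Tree.size]
  omega

theorem beq (henc : Injective (enc : β → Tree)) [DecidableEq β] {f g : α → β} (hf : PT O f)
    (hg : PT O g) : PT O (fun x => decide (f x = g x)) := by
  refine (treeEq.comp₂ (f := fun x => enc (f x)) (g := fun x => enc (g x))
    (hf.of_enc fun _ => rfl) (hg.of_enc fun _ => rfl)).of_enc fun x => ?_
  simp [henc.eq_iff]

end PT
end
end Syllogistic

/-! ### Folds over lists, and oracle calls on words -/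

namespace Syllogistic
open Function

section
variable {O : List Letter → List Letter → ℕ → Prop} {α β γ δ : Type} [TEnc α] [TEnc β] [TEnc γ]
  [TEnc δ]

theorem size_enc (x : α) : (enc x).size = esize x := rfl

theorem length_le_esize (l : List α) : l.length ≤ esize l := by
  induction l with
  | nil => simp
  | cons a l ih => simp; omega

theorem esize_le_of_mem {l : List α} {a : α} (h : a ∈ l) : esize a ≤ esize l := by
  induction l with
  | nil => cases h
  | cons b l ih =>
    rw [esize_cons]
    rcases List.mem_cons.1 h with rfl | h
    · omega
    · have := ih h; omega

/-- The loop of the program for a fold. -/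
def foldLoop (p : Prog) : Prog :=
  .loop .aux (fun a => decide (a = some none)) fun _ =>
    .seq toMain (.seq (.push .main none) p)

/-- The rest of the list lies in `aux`, the parameter and the accumulator on `main`. The bound `M`
is invariant: an iteration enlarges the accumulator by at most `G` and shortens the list by one. The
loop ends by consuming the leaf that closes the list. -/
theorem runs_foldLoop {f : α → γ → β → γ} {p : Prog} {r : Polynomial ℕ}
    (hp : ∀ (z : β × α × γ) m a, Runs O p (st ((enc z).code ++ m) a [] [] [])
      (st ((enc (z.2.1, f z.2.1 z.2.2 z.1)).code ++ m) a [] [] []) (r.eval (esize z)))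
    (x : α) (M G : ℕ) (l : List β) (c : γ) (m a : List Sym)
    (hG : ∀ c, ∀ y ∈ l, esize (f x c y) ≤ esize c + G)
    (hM : esize x + esize c + l.length * G ≤ M) (hy : ∀ y ∈ l, esize y ≤ M) :
    Runs O (foldLoop p) (st ((enc (x, c)).code ++ m) ((enc l).code ++ a) [] [] [])
      (st ((enc (x, l.foldl (f x) c)).code ++ m) a [] [] [])
      (l.length * (7 * M + 5 + r.eval (2 * M + 2)) + 1) := by
  induction l generalizing c with
  | nil => exact (Runs.loop_exit rfl).congr (by simp [Tree.nil]) (by simp)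
  | cons y l ih =>
    have hy' := hy y (by simp)
    have hG' := hG c y (by simp)
    rw [List.length_cons, Nat.succ_mul] at hM
    refine (Runs.loop_next (t := 7 * M + 4 + r.eval (2 * M + 2)) (by simp) ?_ (ih (f x c y)
      (fun c y h => hG c y (by simp [h])) (by omega) (fun y h => hy y (by simp [h])))).mono ?_
    · have h₁ := runs_toMain (O := O) (enc y) ((enc (x, c)).code ++ m) ((enc l).code ++ a)
      have h₂ : Runs O (.push .main none)
          (st ((enc y).code ++ ((enc (x, c)).code ++ m)) ((enc l).code ++ a) [] [] [])
          (st ((enc (y, x, c)).code ++ m) ((enc l).code ++ a) [] [] []) 1 :=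
        (Runs.push ..).congr (by simp) le_rfl
      refine (h₁.seq (h₂.seq (hp (y, x, c) m ((enc l).code ++ a)))).congr' (by simp) rfl ?_
      have h₃ : r.eval (esize (y, x, c)) ≤ r.eval (2 * M + 2) :=
        eval_mono r (by simp; omega)
      simp only [size_enc]
      omega
    · rw [show (y :: l).length = l.length + 1 from rfl, Nat.add_mul, Nat.one_mul]
      omega

namespace PT

/-- The growth allowed by `hq` is additive and its bound does not depend on the accumulator `c`; a
step that doubled its accumulator would reach exponential size. -/
theorem foldl {l : α → List β} {b : α → γ} {f : α → γ → β → γ} (hl : PT O l) (hb : PT O b)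
    (hf : PT O (fun z : α × γ × β => f z.1 z.2.1 z.2.2)) (q : Polynomial ℕ)
    (hq : ∀ x c y, esize (f x c y) ≤ esize c + q.eval (esize x + esize y)) :
    PT O (fun x => (l x).foldl (f x) (b x)) := by
  have hg : PT O (fun z : β × α × γ => (z.2.1, f z.2.1 z.2.2 z.1)) :=
    (fst (snd id)).pair (hf.comp ((fst (snd id)).pair ((snd (snd id)).pair (fst id))))
  obtain ⟨p, r, hp⟩ := hg
  have key : PT O (fun z : List β × α × γ => (z.2.1, z.1.foldl (f z.2.1) z.2.2)) := by
    -- At most `n` iterations, each adding at most `q.eval n`, to an accumulator of size at most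
    -- `n`.
    let M : Polynomial ℕ := Polynomial.X + Polynomial.X * q
    refine ⟨.pop .main fun _ => .seq toAux (foldLoop p),
      Polynomial.X * (7 * M + 5 + r.comp (2 * M + 2)) + 7 * Polynomial.X + 5, ?_⟩
    rintro ⟨l, x, c⟩ m a
    have hn : esize (l, x, c) = esize l + (esize x + esize c + 1) + 1 := by simp
    generalize hN : esize (l, x, c) = n at *
    have hl := length_le_esize l
    have h₁ := runs_toAux (O := O) (enc l) ((enc (x, c)).code ++ m) a
    have h₂ := runs_foldLoop hp x (n + n * q.eval n) (q.eval n) l c m a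
      (fun c y hy => (hq x c y).trans (Nat.add_le_add_left
        (eval_mono q (by have := esize_le_of_mem hy; omega)) _))
      (by have := Nat.mul_le_mul_right (q.eval n) (show l.length ≤ n by omega); omega)
      (fun y hy => by have := esize_le_of_mem hy; omega)
    refine (Runs.pop ((h₁.seq h₂).congr' (by simp) rfl le_rfl)).mono ?_
    have h₃ : l.length * (7 * (n + n * q.eval n) + 5 + r.eval (2 * (n + n * q.eval n) + 2)) ≤
      n * (7 * (n + n * q.eval n) + 5 + r.eval (2 * (n + n * q.eval n) + 2)) :=
      Nat.mul_le_mul_right _ (by omega)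
    simp only [size_enc, M, Polynomial.eval_add, Polynomial.eval_mul, Polynomial.eval_comp,
      Polynomial.eval_X, Polynomial.eval_ofNat]
    omega
  exact snd (key.comp (hl.pair (id.pair hb)))

end PT

/-- The letters of a word on top of `main` are moved to `tmp`. -/
def toTmp : Prog :=
  .loop .main (fun a => decide (a = some none)) fun _ => .pop .main fun a => .push .tmp (a.getD none)

/-- The word in `tmp` is moved to the top of `main`. -/
def fromTmp : Prog :=
  .seq (.push .main (some .endMark)) (.loop .tmp Option.isSome fun a =>
    .seq (.push .main (a.getD none)) (.push .main none))

theorem runs_toTmp (w : List Letter) (m a t : List Sym) :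
    Runs O toTmp (st ((enc w).code ++ m) a t [] []) (st m a (w.reverse.map some ++ t) [] [])
      (3 * w.length + 1) := by
  induction w generalizing t with
  | nil => exact (Runs.loop_exit rfl).congr (by simp [Tree.nil]) (by simp)
  | cons b w ih =>
    refine (Runs.loop_next (by simp) (.pop (Runs.push ..)) ((ih (some b :: t)).congr' ?_ rfl
      le_rfl)).congr ?_ (by simp; omega)
    · simp
    · simp

theorem runs_fromTmp (w : List Letter) (m a : List Sym) :
    Runs O fromTmp (st m a (w.reverse.map some) [] []) (st ((enc w).code ++ m) a [] [] [])
      (3 * w.length + 2) := by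
  suffices h : ∀ (v w : List Letter), Runs O (.loop .tmp Option.isSome fun a =>
      .seq (.push .main (a.getD none)) (.push .main none))
      (st ((enc v).code ++ m) a (w.map some) [] [])
      (st ((enc (w.reverse ++ v)).code ++ m) a [] [] []) (3 * w.length + 1) by
    refine ((Runs.push ..).seq ((h [] w.reverse).congr' (by simp [Tree.nil]) rfl le_rfl)).congr
      (by simp) (by simp; omega)
  intro v w
  induction w generalizing v with
  | nil => exact (Runs.loop_exit rfl).congr (by simp) (by simp)
  | cons b w ih =>
    refine (Runs.loop_next (by simp) ((Runs.push ..).seq (Runs.push ..)) ((ih (b :: v)).congr' ?_ rfl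
      le_rfl)).congr (by simp) (by simp; omega)
    simp

/-- The elements of a type as words, by means of a given encoding. -/
structure Word {α : Type} (e : α → List Letter) where
  val : α

instance {α : Type} (e : α → List Letter) : TEnc (Word e) := ⟨fun x => enc (e x.val)⟩

theorem esize_letters (w : List Letter) : esize w = 2 * w.length + 1 := by
  induction w with
  | nil => rfl
  | cons a w ih => simp [ih]; omega

/-- Lists of letters are unpacked to a plain reversed word in `tmp`, the form `Runs.call` requires,
and the answer is packed again. Besides the running time, the length of the answer needs a bound. -/
theorem PT.call {α : Type} {e : α → List Letter} {f : α → List Letter} (q : Polynomial ℕ)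
    (h : ∀ x, ∃ t, O (e x) (f x) t ∧ t + (f x).length ≤ q.eval (e x).length) :
    PT O (fun x : Word e => f x.val) := by
  refine ⟨.seq toTmp (.seq .call fromTmp), 4 * q + 4 * Polynomial.X + 5, fun x m a => ?_⟩
  obtain ⟨t, hO, ht⟩ := h x.val
  have h₁ := runs_toTmp (O := O) (e x.val) m a []
  have h₂ := Runs.call (S := st m a ((e x.val).reverse.map some) [] []) rfl hO
  have h₃ := runs_fromTmp (O := O) (f x.val) m a
  refine (h₁.seq (((h₂.congr' (by simp) (by simp) le_rfl)).seq h₃)).congr' rfl rfl ?_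
  have e₁ : esize x = 2 * (e x.val).length + 1 := esize_letters _
  have := eval_mono q (show (e x.val).length ≤ esize x by omega)
  simp
  omega

end

theorem polyTime_of_pt {A : Oracle} {α : Type} {e : α → List Letter} {f : α → Bool}
    (h : PT A.Answers (fun x : Word e => f x.val)) :
    Nonempty (Turing.TM2ComputableInPolyTime e Computability.encodeBool f) := by
  obtain ⟨p, q, h⟩ := h
  refine polyTime_of_runs (A := A) (.seq fromTmp p)
    (3 * Polynomial.X + 2 + q.comp (2 * Polynomial.X + 1)) fun x => ?_
  refine ((runs_fromTmp (e x) [] []).seq (h ⟨x⟩ [] [])).congr' ?_ ?_ ?_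
  · funext r; cases r <;> simp
  · funext r; cases r <;> simp
  · have e₁ : esize (⟨x⟩ : Word e) = 2 * (e x).length + 1 := esize_letters _
    simp [e₁]

end Syllogistic

/-! ### Closure of `PT` under list and Boolean operations -/

namespace Syllogistic
open Function

namespace PT

variable {O : List Letter → List Letter → ℕ → Prop} {α β γ δ : Type} [TEnc α] [TEnc β] [TEnc γ]
  [TEnc δ]

theorem cons {f : α → β} {l : α → List β} (hf : PT O f) (hl : PT O l) :
    PT O (fun x => f x :: l x) :=
  (hf.pair hl).of_enc fun _ => rfl

theorem reverse {l : α → List β} (hl : PT O l) : PT O (fun x => (l x).reverse) := by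
  have h : PT O (fun z : α × List β × β => z.2.2 :: z.2.1) := cons (snd (snd id)) (fst (snd id))
  refine (foldl (f := fun _ c y => y :: c) hl (const []) h (Polynomial.X + 1) fun x c y => ?_).of_enc
    fun x => ?_
  · simp; omega
  · simp

theorem foldr {l : α → List β} {b : α → γ} {f : α → β → γ → γ} (hl : PT O l) (hb : PT O b)
    (hf : PT O (fun z : α × β × γ => f z.1 z.2.1 z.2.2)) (q : Polynomial ℕ)
    (hq : ∀ x y c, esize (f x y c) ≤ esize c + q.eval (esize x + esize y)) :
    PT O (fun x => (l x).foldr (f x) (b x)) := by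
  have h : PT O (fun z : α × γ × β => f z.1 z.2.2 z.2.1) :=
    hf.comp ((fst id).pair ((snd (snd id)).pair (fst (snd id))))
  refine (foldl (f := fun x c y => f x y c) hl.reverse hb h q fun x c y => hq x y c).of_enc
    fun x => ?_
  simp

theorem esize_append (l l' : List α) : esize (l ++ l') + 1 = esize l + esize l' := by
  induction l with
  | nil => simp; omega
  | cons a l ih => simp; omega

theorem append {l l' : α → List β} (hl : PT O l) (hl' : PT O l') :
    PT O (fun x => l x ++ l' x) := by
  have h : PT O (fun z : α × β × List β => z.2.1 :: z.2.2) := cons (fst (snd id)) (snd (snd id))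
  refine (foldr (f := fun _ y c => y :: c) hl hl' h (Polynomial.X + 1) fun x y c => ?_).of_enc
    fun x => ?_
  · simp; omega
  · simp

theorem flatMap {l : α → List β} {f : α → β → List γ} (hl : PT O l)
    (hf : PT O (fun z : α × β => f z.1 z.2)) : PT O (fun x => (l x).flatMap (f x)) := by
  have h : PT O (fun z : α × β × List γ => f z.1 z.2.1 ++ z.2.2) :=
    append (hf.comp ((fst id).pair (fst (snd id)))) (snd (snd id))
  obtain ⟨q, hq⟩ := hf.esize_le
  refine (foldr (f := fun x y c => f x y ++ c) hl (const []) h (q.comp (Polynomial.X + 1))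
    fun x y c => ?_).of_enc fun x => ?_
  · have := hq (x, y)
    have := esize_append (f x y) c
    simp at *; omega
  · congr 1
    induction l x with
    | nil => rfl
    | cons y l ih => simp [ih]

theorem map {l : α → List β} {f : α → β → γ} (hl : PT O l)
    (hf : PT O (fun z : α × β => f z.1 z.2)) : PT O (fun x => (l x).map (f x)) := by
  refine (flatMap (f := fun x y => [f x y]) hl (cons hf (const []))).of_enc fun x => ?_
  congr 1
  induction l x with
  | nil => rfl
  | cons y l ih => simp_all

theorem filter {l : α → List β} {c : α → β → Bool} (hl : PT O l)
    (hc : PT O (fun z : α × β => c z.1 z.2)) : PT O (fun x => (l x).filter (c x)) := by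
  refine (flatMap (f := fun x y => if c x y then [y] else []) hl
    (ite hc (cons (snd id) (const [])) (const []))).of_enc fun x => ?_
  congr 1
  induction l x with
  | nil => rfl
  | cons y l ih => by_cases h : c x y <;> simp_all

theorem and {b c : α → Bool} (hb : PT O b) (hc : PT O c) : PT O (fun x => b x && c x) :=
  (ite hb hc (const false)).of_enc fun x => by cases b x <;> simp

theorem or {b c : α → Bool} (hb : PT O b) (hc : PT O c) : PT O (fun x => b x || c x) :=
  (ite hb (const true) hc).of_enc fun x => by cases b x <;> simp

theorem not {b : α → Bool} (hb : PT O b) : PT O (fun x => !b x) :=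
  (ite hb (const false) (const true)).of_enc fun x => by cases b x <;> simp

theorem any {l : α → List β} {c : α → β → Bool} (hl : PT O l)
    (hc : PT O (fun z : α × β => c z.1 z.2)) : PT O (fun x => (l x).any (c x)) := by
  have h : PT O (fun z : α × β × Bool => c z.1 z.2.1 || z.2.2) :=
    or (hc.comp ((fst id).pair (fst (snd id)))) (snd (snd id))
  refine (foldr (f := fun x y b => c x y || b) hl (const false) h 1 fun x y b => ?_).of_enc
    fun x => ?_
  · simp
  · congr 1
    induction l x with
    | nil => rfl
    | cons y l ih => simp_all

theorem all {l : α → List β} {c : α → β → Bool} (hl : PT O l)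
    (hc : PT O (fun z : α × β => c z.1 z.2)) : PT O (fun x => (l x).all (c x)) :=
  (not (any hl (c := fun x y => !c x y) (not hc))).of_enc fun x => by
    simp only [List.any_eq_not_all_not, Bool.not_not]

theorem headD {l : α → List Tree} (hl : PT O l) : PT O (fun x => (l x).headD .nil) :=
  (treeLeft.comp (f := fun x => enc (l x)) (hl.of_enc fun _ => rfl)).of_enc fun x => by
    cases l x <;> rfl

theorem tail {l : α → List β} (hl : PT O l) : PT O (fun x => (l x).tail) :=
  (treeRight.comp (f := fun x => enc (l x)) (hl.of_enc fun _ => rfl)).of_enc fun x => by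
    cases l x <;> rfl

theorem node {f g : α → Tree} (hf : PT O f) (hg : PT O g) : PT O (fun x => Tree.node (f x) (g x)) :=
  (hf.pair hg).of_enc fun _ => rfl

theorem left {f : α → Tree} (hf : PT O f) : PT O (fun x => (f x).left) := treeLeft.comp hf

theorem right {f : α → Tree} (hf : PT O f) : PT O (fun x => (f x).right) := treeRight.comp hf

theorem toTree {f : α → β} (hf : PT O f) : PT O (fun x => enc (f x)) := hf.of_enc fun _ => rfl

end PT
end Syllogistic

namespace Syllogistic
open Function

/-! ### Terms and sentences as trees -/

theorem enc_list_injective {α : Type} [TEnc α] (h : Injective (enc : α → Tree)) :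
    Injective (enc : List α → Tree) := by
  intro l l' e
  induction l generalizing l' with
  | nil => cases l' with
    | nil => rfl
    | cons => cases e
  | cons a l ih => cases l' with
    | nil => cases e
    | cons a' l' =>
      simp only [enc_cons, Tree.node.injEq] at e
      rw [h e.1, ih e.2]

theorem enc_word_injective : Injective (enc : List Bool → Tree) :=
  enc_list_injective fun a b h => by simpa using h

section Codes

variable {L : Language} {P R : Type} (cP : P → List Bool) (cR : R → List Bool)

/-- The tree that represents a term. -/
def Term.code : Term L P R → Tree
  | .noun p => .node (.leaf .noun) (enc (cP p))
  | .allTerm _ r x => .node (.leaf .allTerm) (.node (enc (cR r)) x.code)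
  | .someTerm _ r x => .node (.leaf .someTerm) (.node (enc (cR r)) x.code)
  | .compl _ x => .node (.leaf .compl) x.code

/-- The first letter of the encoding of a sentence. -/
def Sentence.tag : Sentence L P R → Letter
  | .all .. => .all
  | .some .. => .some
  | .allOrSome .. => .allOrSome
  | .disjoint .. => .disjoint
  | .overlap .. => .overlap

/-- The terms of a sentence. -/
def Sentence.args : Sentence L P R → List (Term L P R)
  | .all _ x y => [x, y]
  | .some _ x y => [x, y]
  | .allOrSome _ a b x y => [a, b, x, y]
  | .disjoint _ x xs => x :: xs
  | .overlap _ x xs => x :: xs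

/-- The end of the list of trees that represents the terms of a sentence. -/
def endTrees : Letter → List Tree
  | .disjoint => [.nil]
  | .overlap => [.nil]
  | _ => []

/-- The tree that represents a sentence. -/
def Sentence.code (s : Sentence L P R) : Tree :=
  .node (.leaf s.tag) (enc (s.args.map (Term.code cP cR) ++ endTrees s.tag))

variable {cP cR}

theorem Term.code_injective (hP : Injective cP) (hR : Injective cR) :
    Injective (Term.code cP cR : Term L P R → Tree) := by
  intro x y e
  induction x generalizing y with
  | noun p => cases y with
    | noun q =>
      simp only [code, Tree.node.injEq, true_and, enc_word_injective.eq_iff, hP.eq_iff] at e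
      rw [e]
    | _ => simp [code] at e
  | allTerm h r x ih => cases y with
    | allTerm h' r' y =>
      simp only [code, Tree.node.injEq, true_and, enc_word_injective.eq_iff, hR.eq_iff] at e
      rw [e.1, ih e.2]
    | _ => simp [code] at e
  | someTerm h r x ih => cases y with
    | someTerm h' r' y =>
      simp only [code, Tree.node.injEq, true_and, enc_word_injective.eq_iff, hR.eq_iff] at e
      rw [e.1, ih e.2]
    | _ => simp [code] at e
  | compl h x ih => cases y with
    | compl h' y =>
      simp only [code, Tree.node.injEq, true_and] at e
      rw [ih e]
    | _ => simp [code] at e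

/-- This tells terms from the leaf that closes a list of arguments. -/
theorem Term.root_code (x : Term L P R) : (x.code cP cR).root = none := by cases x <;> rfl

theorem Sentence.ext_args {s s' : Sentence L P R} (h : s.tag = s'.tag) (h' : s.args = s'.args) :
    s = s' := by
  cases s <;> cases s' <;> simp_all [tag, args]

theorem Sentence.code_injective (hP : Injective cP) (hR : Injective cR) :
    Injective (Sentence.code cP cR : Sentence L P R → Tree) := by
  intro s s' e
  simp only [code, Tree.node.injEq, Tree.leaf.injEq] at e
  obtain ⟨e₁, e₂⟩ := e
  have e₃ := enc_list_injective (fun _ _ h => h) e₂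
  rw [e₁, List.append_cancel_right_eq] at e₃
  exact ext_args e₁ (List.map_injective_iff.2 (Term.code_injective hP hR) e₃)

/-! ### Parsing -/

/-- One step of the parser, which reads a word from the right.  Its state consists of the trees that
wait for the beginning of their sentence, and of the sentences that have been read. -/
def parseStep : Letter → List Tree × List Tree → List Tree × List Tree
  | .bit b, s => (.node (.leaf (.bit b)) (s.1.headD .nil) :: s.1.tail, s.2)
  | .endMark, s => (.nil :: s.1, s.2)
  | .noun, s => (.node (.leaf .noun) (s.1.headD .nil) :: s.1.tail, s.2)
  | .compl, s => (.node (.leaf .compl) (s.1.headD .nil) :: s.1.tail, s.2)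
  | .allTerm, s =>
      (.node (.leaf .allTerm) (.node (s.1.headD .nil) (s.1.tail.headD .nil)) :: s.1.tail.tail, s.2)
  | .someTerm, s =>
      (.node (.leaf .someTerm) (.node (s.1.headD .nil) (s.1.tail.headD .nil)) :: s.1.tail.tail, s.2)
  | a, s => ([], .node (.leaf a) (enc s.1) :: s.2)

/-- The sentences of a word, as trees. -/
def parse (w : List Letter) : List Tree := (w.foldr parseStep ([], [])).2

theorem foldr_parseStep_name (w : List Bool) (c d : List Tree) :
    (encodeName w).foldr parseStep (c, d) = (enc w :: c, d) := by
  induction w with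
  | nil => rfl
  | cons b w ih =>
    simp only [encodeName, List.map_cons, List.cons_append, List.foldr_cons] at ih ⊢
    rw [ih]
    rfl

/-- Read from the right, prefix notation becomes postfix notation: when a term former is met, its
arguments are already on top of the waiting trees. -/
theorem foldr_parseStep_term (x : Term L P R) (c d : List Tree) :
    (x.encode cP cR).foldr parseStep (c, d) = (x.code cP cR :: c, d) := by
  induction x generalizing c with
  | noun p => simp [Term.encode, foldr_parseStep_name, parseStep, Term.code]
  | allTerm h r x ih => simp [Term.encode, foldr_parseStep_name, ih, parseStep, Term.code]
  | someTerm h r x ih => simp [Term.encode, foldr_parseStep_name, ih, parseStep, Term.code]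
  | compl h x ih => simp [Term.encode, ih, parseStep, Term.code]

theorem foldr_parseStep_terms (xs : List (Term L P R)) (c d : List Tree) :
    (xs.flatMap (Term.encode cP cR)).foldr parseStep (c, d) =
      (xs.map (Term.code cP cR) ++ c, d) := by
  induction xs with
  | nil => rfl
  | cons x xs ih =>
    rw [List.flatMap_cons, List.foldr_append, ih, foldr_parseStep_term]
    rfl

theorem Sentence.encode_eq (s : Sentence L P R) :
    s.encode cP cR = s.tag :: (s.args.flatMap (Term.encode cP cR) ++
      (endTrees s.tag).map fun _ => .endMark) := by
  cases s <;> simp [encode, tag, args, endTrees]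

/-- The first letter of a sentence collects all waiting trees, so none may wait beforehand. The
closing mark of a list sentence is itself read as a tree, which `endTrees` accounts for. -/
theorem foldr_parseStep_sentence (s : Sentence L P R) (d : List Tree) :
    (s.encode cP cR).foldr parseStep ([], d) = ([], s.code cP cR :: d) := by
  rw [Sentence.encode_eq, List.foldr_cons, List.foldr_append]
  have h : ((endTrees s.tag).map fun _ => Letter.endMark).foldr parseStep ([], d) =
      (endTrees s.tag, d) := by
    cases s <;> rfl
  rw [h, foldr_parseStep_terms]
  cases s <;> rfl

theorem foldr_parseStep_theory (Γ : List (Sentence L P R)) (d : List Tree) :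
    (encodeTheory cP cR Γ).foldr parseStep ([], d) = ([], Γ.map (Sentence.code cP cR) ++ d) := by
  induction Γ with
  | nil => rfl
  | cons s Γ ih =>
    rw [encodeTheory, List.flatMap_cons, List.foldr_append, ← encodeTheory, ih,
      foldr_parseStep_sentence]
    rfl

theorem parse_encodeTheory (Γ : List (Sentence L P R)) :
    parse (encodeTheory cP cR Γ) = Γ.map (Sentence.code cP cR) := by
  rw [parse, foldr_parseStep_theory, List.append_nil]

/-- No tree is waiting when the separator is met, so it is read as a dummy sentence without
arguments. -/
theorem parse_encodeInput (Γ : List (Sentence L P R)) (φ : Sentence L P R) :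
    parse (encodeInput cP cR (Γ, φ)) =
      Γ.map (Sentence.code cP cR) ++ [.node (.leaf .turnstile) .nil, φ.code cP cR] := by
  rw [parse, encodeInput, List.foldr_append, List.foldr_cons, foldr_parseStep_sentence]
  exact congrArg Prod.snd (foldr_parseStep_theory Γ _)

theorem turnstile_notMem_encodeName (w : List Bool) : Letter.turnstile ∉ encodeName w := by
  simp [encodeName]

theorem turnstile_notMem_term (x : Term L P R) : Letter.turnstile ∉ x.encode cP cR := by
  induction x <;> simp_all [Term.encode, turnstile_notMem_encodeName]

theorem turnstile_notMem_sentence (s : Sentence L P R) : Letter.turnstile ∉ s.encode cP cR := by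
  rw [Sentence.encode_eq]
  cases s <;> simp [Sentence.tag, turnstile_notMem_term]

/-- The input for the machine of `f` is obtained by deleting the separator, so trees never have to
be written back as words. -/
theorem filter_encodeInput (Γ : List (Sentence L P R)) (φ : Sentence L P R) :
    (encodeInput cP cR (Γ, φ)).filter (fun a => !decide (a = .turnstile)) =
      encodeTheory cP cR (Γ ++ [φ]) := by
  have h₁ : ∀ a ∈ encodeTheory cP cR Γ, (!decide (a = Letter.turnstile)) = true := by
    intro a ha
    obtain ⟨s, -, hs⟩ := List.mem_flatMap.1 ha
    have := turnstile_notMem_sentence (cP := cP) (cR := cR) s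
    simpa using fun e : a = .turnstile => this (e ▸ hs)
  have h₂ : ∀ a ∈ φ.encode cP cR, (!decide (a = Letter.turnstile)) = true := by
    intro a ha
    have := turnstile_notMem_sentence (cP := cP) (cR := cR) φ
    simpa using fun e : a = .turnstile => this (e ▸ ha)
  rw [encodeInput, List.filter_append, List.filter_eq_self.2 h₁, List.filter_cons_of_neg (by simp),
    List.filter_eq_self.2 h₂]
  simp [encodeTheory]

end Codes

/-! ### The parser in polynomial time -/

namespace PT
variable {O : List Letter → List Letter → ℕ → Prop} {α : Type} [TEnc α]

theorem esize_headD_add_tail (l : List Tree) :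
    esize (l.headD .nil) + esize l.tail ≤ esize l + 1 := by
  cases l <;> simp [Tree.nil]; omega

/-- Each letter adds a bounded number of symbols: the additive growth that `PT.foldr` needs. -/
theorem esize_parseStep (a : Letter) (s : List Tree × List Tree) :
    esize (parseStep a s) ≤ esize s + 10 := by
  obtain ⟨c, d⟩ := s
  have h₁ := esize_headD_add_tail c
  have h₂ := esize_headD_add_tail c.tail
  cases a <;> simp only [parseStep, esize_prod, esize_cons, esize_tree, Tree.size_node,
    Tree.size_leaf, Tree.nil, size_enc, esize_nil] at * <;> omega

theorem parse {w : α → List Letter} (hw : PT O w) : PT O (fun x => parse (w x)) := by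
  have hs : PT O (fun z : α × Letter × List Tree × List Tree => parseStep z.2.1 z.2.2) := by
    have h₁ : PT O (fun z : α × Letter × List Tree × List Tree => z.2.2.1) := fst (snd (snd id))
    have h₂ : PT O (fun z : α × Letter × List Tree × List Tree => z.2.2.2) := snd (snd (snd id))
    refine switch (c := fun z : α × Letter × List Tree × List Tree => z.2.1) (fst (snd id))
      (g := fun a z => parseStep a z.2.2) fun a => ?_
    cases a
    case bit b => exact (cons (node (const _) (headD h₁)) (tail h₁)).pair h₂
    case endMark => exact (cons (const _) h₁).pair h₂
    case noun => exact (cons (node (const _) (headD h₁)) (tail h₁)).pair h₂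
    case compl => exact (cons (node (const _) (headD h₁)) (tail h₁)).pair h₂
    case allTerm =>
      exact (cons (node (const _) (node (headD h₁) (headD (tail h₁)))) (tail (tail h₁))).pair h₂
    case someTerm =>
      exact (cons (node (const _) (node (headD h₁) (headD (tail h₁)))) (tail (tail h₁))).pair h₂
    all_goals exact (const []).pair (cons (node (const _) (toTree h₁)) h₂)
  exact snd (foldr (f := fun _ a s => parseStep a s) hw (const ([], [])) hs 10
    fun _ a s => by simpa using esize_parseStep a s)

end PT
end Syllogistic

namespace Syllogistic
open Function

/-! ### Matching templates -/

/-- The variables of templates. -/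
inductive Var : Type
  | noun (n : ℕ)
  | verb (n : ℕ)
  | term (n : ℕ)
  | sent (n : ℕ)
  deriving DecidableEq

/-- The tree that represents a natural number. -/
def natTree : ℕ → Tree
  | 0 => .nil
  | n + 1 => .node .nil (natTree n)

theorem natTree_injective : Injective natTree := by
  intro m n e
  induction m generalizing n with
  | zero => cases n <;> simp_all [natTree, Tree.nil]
  | succ m ih => cases n with
    | zero => simp [natTree, Tree.nil] at e
    | succ n => simp only [natTree, Tree.node.injEq, true_and] at e; rw [ih e]

instance : TEnc Var := ⟨fun
  | .noun n => .node (.leaf .noun) (natTree n)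
  | .verb n => .node (.leaf .allTerm) (natTree n)
  | .term n => .node (.leaf .compl) (natTree n)
  | .sent n => .node (.leaf .all) (natTree n)⟩

theorem enc_var_injective : Injective (enc : Var → Tree) := by
  intro v w e
  cases v <;> cases w <;> simp [enc, TEnc.toTree, natTree_injective.eq_iff] at e <;> rw [e]

section Matching

variable {L : Language} {P R : Type} (cP : P → List Bool) (cR : R → List Bool)

/-- The tree that represents the value of a variable under a substitution. -/
def Substitution.lookup (σ : Substitution L P R) : Var → Option Tree
  | .noun n => (σ.noun n).map fun p => enc (cP p)
  | .verb n => (σ.verb n).map fun r => enc (cR r)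
  | .term n => (σ.term n).map (Term.code cP cR)
  | .sent n => (σ.sent n).map (Sentence.code cP cR)

/-- The values of the variables of a template in a tree. -/
def TermTemplate.bindings : TermTemplate L → Tree → List (Var × Tree)
  | .nounVar n, x => [(.noun n, x.right)]
  | .termVar n, x => [(.term n, x)]
  | .allTerm _ n t, x => (.verb n, x.right.left) :: t.bindings x.right.right
  | .someTerm _ n t, x => (.verb n, x.right.left) :: t.bindings x.right.right
  | .compl _ t, x => t.bindings x.right

/-- Whether a tree has the shape of a template. -/
def TermTemplate.shape : TermTemplate L → Tree → Bool
  | .nounVar _, x => decide (x.left = .leaf .noun)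
  | .termVar _, _ => true
  | .allTerm _ _ t, x => decide (x.left = .leaf .allTerm) && t.shape x.right.right
  | .someTerm _ _ t, x => decide (x.left = .leaf .someTerm) && t.shape x.right.right
  | .compl _ t, x => decide (x.left = .leaf .compl) && t.shape x.right

/-- The values of the variables of a list of templates in a list of trees. -/
def bindingsList : List (TermTemplate L) → Tree → List (Var × Tree)
  | [], _ => []
  | t :: ts, x => t.bindings x.left ++ bindingsList ts x.right

/-- Whether the trees in a list have the shapes of the templates in a list. -/
def shapeList : List (TermTemplate L) → Tree → Bool
  | [], x => x.left.root.isSome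
  | t :: ts, x => x.left.root.isNone && (t.shape x.left && shapeList ts x.right)

/-- The first letter and the terms of a template that is not a variable. -/
def SentenceTemplate.parts : SentenceTemplate L → ℕ ⊕ Letter × List (TermTemplate L)
  | .sentVar n => .inl n
  | .all _ x y => .inr (.all, [x, y])
  | .some _ x y => .inr (.some, [x, y])
  | .allOrSome _ a b x y => .inr (.allOrSome, [a, b, x, y])
  | .disjoint _ x xs => .inr (.disjoint, x :: xs)
  | .overlap _ x xs => .inr (.overlap, x :: xs)

/-- The values of the variables of a template in a tree. -/
def SentenceTemplate.bindings (τ : SentenceTemplate L) (s : Tree) : List (Var × Tree) :=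
  match τ.parts with
  | .inl n => [(.sent n, s)]
  | .inr (_, ts) => bindingsList ts s.right

/-- Whether a tree has the shape of a template. -/
def SentenceTemplate.shape (τ : SentenceTemplate L) (s : Tree) : Bool :=
  match τ.parts with
  | .inl _ => true
  | .inr (a, ts) => decide (s.left = .leaf a) && shapeList ts s.right

/-- Whether a list of values of variables assigns at most one value to each variable. -/
def consistent (B : List (Var × Tree)) : Bool :=
  B.all fun b => B.all fun b' => !decide (b.1 = b'.1) || decide (b.2 = b'.2)

/-- The values of variables for which the templates in a list become members of the list `D`. -/
def matches' (D : List Tree) : List (SentenceTemplate L) → List (List (Var × Tree))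
  | [] => [[]]
  | τ :: τs => (matches' D τs).flatMap fun B =>
      (D.filter τ.shape).map fun s => τ.bindings s ++ B

/-- Whether a sentence follows by a rule from premises in the list `D`. -/
def Rule.fires (ρ : Rule L) (D : List Tree) (a : Tree) : Bool :=
  ρ.conclusion.shape a &&
    (matches' D ρ.premises).any fun B => consistent (ρ.conclusion.bindings a ++ B)

variable {cP cR}

section
variable (σ : Substitution L P R) (n : ℕ)

@[simp] theorem lookup_noun :
    σ.lookup cP cR (.noun n) = (σ.noun n).map fun p => enc (cP p) := rfl
@[simp] theorem lookup_verb :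
    σ.lookup cP cR (.verb n) = (σ.verb n).map fun r => enc (cR r) := rfl
@[simp] theorem lookup_term :
    σ.lookup cP cR (.term n) = (σ.term n).map (Term.code cP cR) := rfl
@[simp] theorem lookup_sent :
    σ.lookup cP cR (.sent n) = (σ.sent n).map (Sentence.code cP cR) := rfl

end

theorem map_eq_some_iff_of_injective {α β : Type} {f : α → β} (hf : Injective f) {o : Option α}
    {a : α} : o.map f = some (f a) ↔ o = some a := by
  rw [← Option.map_some, (Option.map_injective hf).eq_iff]

/-- This splits matching into a condition on the tree alone and a list of equations for `σ`. The
bindings are meaningful only together with the shape, because `left` and `right` return leaves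
unchanged. -/
theorem TermTemplate.subst_eq_some (hP : Injective cP) (hR : Injective cR)
    (σ : Substitution L P R) (t : TermTemplate L) (x : Term L P R) :
    t.subst σ = some x ↔ t.shape (x.code cP cR) = true ∧
      ∀ b ∈ t.bindings (x.code cP cR), σ.lookup cP cR b.1 = some b.2 := by
  have hP' (o : Option P) (p) : o.map (fun p => enc (cP p)) = some (enc (cP p)) ↔ o = some p :=
    map_eq_some_iff_of_injective (enc_word_injective.comp hP)
  have hR' (o : Option R) (r) : o.map (fun r => enc (cR r)) = some (enc (cR r)) ↔ o = some r :=
    map_eq_some_iff_of_injective (enc_word_injective.comp hR)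
  have hT (o) (x : Term L P R) : o.map (Term.code cP cR) = some (x.code cP cR) ↔ o = some x :=
    map_eq_some_iff_of_injective (Term.code_injective hP hR)
  induction t generalizing x with
  | termVar n => simp [subst, shape, bindings, hT]
  | nounVar n =>
    cases x <;> simp [subst, shape, bindings, Term.code, Tree.left, Tree.right, hP']
  | allTerm h n t ih =>
    cases x <;>
      simp [subst, shape, bindings, Term.code, Tree.left, Tree.right, hR', ih,
        Option.bind_eq_some_iff]
    tauto
  | someTerm h n t ih =>
    cases x <;>
      simp [subst, shape, bindings, Term.code, Tree.left, Tree.right, hR', ih,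
        Option.bind_eq_some_iff]
    tauto
  | compl h t ih =>
    cases x <;> simp [subst, shape, bindings, Term.code, Tree.left, Tree.right, ih]

theorem mapM_subst_eq_some (hP : Injective cP) (hR : Injective cR)
    (σ : Substitution L P R) (ts : List (TermTemplate L)) (xs : List (Term L P R)) (a : Letter) :
    ts.mapM (TermTemplate.subst σ) = some xs ↔
      shapeList ts (enc (xs.map (Term.code cP cR) ++ endTrees a)) = true ∧
      ∀ b ∈ bindingsList ts (enc (xs.map (Term.code cP cR) ++ endTrees a)),
        σ.lookup cP cR b.1 = some b.2 := by
  -- A list of arguments ends either in the leaf `.nil` or in a node with left subtree `.nil`. As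
  -- `left` fixes leaves, both endings show a leaf where another term would show a node.
  have hroot : (enc (endTrees a)).left.root.isSome = true := by
    unfold endTrees; split <;> rfl
  induction ts generalizing xs with
  | nil =>
    cases xs with
    | nil => simpa [shapeList, bindingsList] using hroot
    | cons x xs => simp [shapeList, Tree.left, Term.root_code]
  | cons t ts ih =>
    cases xs with
    | nil =>
      have : (enc (endTrees a)).left.root.isNone = false := by
        rw [← Option.not_isSome, hroot]; rfl
      simp [shapeList, this, Option.bind_eq_some_iff]
    | cons x xs =>
      simp [shapeList, bindingsList, Tree.left, Tree.right, Term.root_code, Option.bind_eq_some_iff,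
        or_imp, forall_and, ih, TermTemplate.subst_eq_some hP hR]
      tauto

theorem SentenceTemplate.subst_eq_some_iff_parts (σ : Substitution L P R) (τ : SentenceTemplate L)
    (s : Sentence L P R) : τ.subst σ = .some s ↔ match τ.parts with
      | .inl n => σ.sent n = .some s
      | .inr (a, ts) => s.tag = a ∧ ts.mapM (TermTemplate.subst σ) = .some s.args := by
  cases τ <;> cases s <;>
    simp [subst, parts, Sentence.tag, Sentence.args, Option.bind_eq_some_iff]

theorem SentenceTemplate.subst_eq_some (hP : Injective cP) (hR : Injective cR)
    (σ : Substitution L P R) (τ : SentenceTemplate L) (s : Sentence L P R) :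
    τ.subst σ = .some s ↔ τ.shape (s.code cP cR) = true ∧
      ∀ b ∈ τ.bindings (s.code cP cR), σ.lookup cP cR b.1 = .some b.2 := by
  have hS (o : Option (Sentence L P R)) (s) :
      o.map (Sentence.code cP cR) = .some (s.code cP cR) ↔ o = .some s :=
    map_eq_some_iff_of_injective (Sentence.code_injective hP hR)
  rw [subst_eq_some_iff_parts]
  unfold shape bindings
  cases τ.parts with
  | inl n => simp [hS]
  | inr z =>
    simp only [mapM_subst_eq_some hP hR σ z.2 s.args s.tag]
    simp [Sentence.code, Tree.left, Tree.right, and_assoc]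

/-- The tree `x` is a possible value of the variable `v`. -/
def Admissible (L : Language) (cP : P → List Bool) (cR : R → List Bool) (b : Var × Tree) : Prop :=
  match b.1 with
  | .noun _ => ∃ p, enc (cP p) = b.2
  | .verb _ => ∃ r, enc (cR r) = b.2
  | .term _ => ∃ x : Term L P R, x.code cP cR = b.2
  | .sent _ => ∃ s : Sentence L P R, s.code cP cR = b.2

/-- Parts cut out of the code of a genuine term are again codes of genuine nouns, verbs and terms,
so bindings can be pulled back to a substitution. -/
theorem TermTemplate.admissible_bindings (t : TermTemplate L) (x : Term L P R)
    (h : t.shape (x.code cP cR) = true) : ∀ b ∈ t.bindings (x.code cP cR), Admissible L cP cR b := by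
  induction t generalizing x with
  | termVar n => simpa [bindings] using ⟨x, rfl⟩
  | nounVar n =>
    cases x <;> simp [shape, Term.code, Tree.left] at h
    simpa [bindings, Term.code, Tree.right] using ⟨_, rfl⟩
  | allTerm h n t ih =>
    cases x <;> simp [shape, Term.code, Tree.left, Tree.right] at h
    simp only [bindings, Term.code, Tree.right, Tree.left, List.forall_mem_cons]
    exact ⟨⟨_, rfl⟩, ih _ h⟩
  | someTerm h n t ih =>
    cases x <;> simp [shape, Term.code, Tree.left, Tree.right] at h
    simp only [bindings, Term.code, Tree.right, Tree.left, List.forall_mem_cons]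
    exact ⟨⟨_, rfl⟩, ih _ h⟩
  | compl h t ih =>
    cases x <;> simp [shape, Term.code, Tree.left, Tree.right] at h
    exact ih _ h

theorem admissible_bindingsList (ts : List (TermTemplate L)) (xs : List (Term L P R)) (a : Letter)
    (h : shapeList ts (enc (xs.map (Term.code cP cR) ++ endTrees a)) = true) :
    ∀ b ∈ bindingsList ts (enc (xs.map (Term.code cP cR) ++ endTrees a)),
      Admissible L cP cR b := by
  have hroot : (enc (endTrees a)).left.root.isSome = true := by
    unfold endTrees; split <;> rfl
  induction ts generalizing xs with
  | nil => simp [bindingsList]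
  | cons t ts ih =>
    cases xs with
    | nil =>
      have : (enc (endTrees a)).left.root.isNone = false := by
        rw [← Option.not_isSome, hroot]; rfl
      simp [shapeList, this] at h
    | cons x xs =>
      simp only [List.map_cons, List.cons_append, enc_cons, enc_tree, shapeList, Tree.left,
        Tree.right, Bool.and_eq_true] at h
      simp only [List.map_cons, List.cons_append, enc_cons, enc_tree, bindingsList, Tree.left,
        Tree.right, List.forall_mem_append]
      exact ⟨t.admissible_bindings x h.2.1, ih xs h.2.2⟩

theorem SentenceTemplate.admissible_bindings (τ : SentenceTemplate L) (s : Sentence L P R)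
    (h : τ.shape (s.code cP cR) = true) : ∀ b ∈ τ.bindings (s.code cP cR), Admissible L cP cR b := by
  unfold shape at h
  unfold bindings
  cases hτ : τ.parts with
  | inl n => simpa using ⟨s, rfl⟩
  | inr z =>
    simp only [hτ, Bool.and_eq_true] at h
    exact admissible_bindingsList z.2 s.args s.tag h.2

theorem exists_substitution_iff {B : List (Var × Tree)} (hB : ∀ b ∈ B, Admissible L cP cR b) :
    (∃ σ : Substitution L P R, ∀ b ∈ B, σ.lookup cP cR b.1 = some b.2) ↔ consistent B = true := by
  classical
  simp only [consistent, List.all_eq_true, Bool.or_eq_true, Bool.not_eq_true', decide_eq_true_eq,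
    decide_eq_false_iff_not, ← imp_iff_not_or]
  constructor
  · rintro ⟨σ, h⟩ b hb b' hb' e
    have h₁ := h b hb
    rw [e, h b' hb'] at h₁
    exact (Option.some.inj h₁).symm
  · intro h
    -- Variables not bound in `B` remain undefined, so nothing has to be chosen from the possibly
    -- empty `P` and `R`.
    let σ : Substitution L P R :=
      { noun := fun n => if h : ∃ p, (Var.noun n, enc (cP p)) ∈ B then some h.choose else none
        verb := fun n => if h : ∃ r, (Var.verb n, enc (cR r)) ∈ B then some h.choose else none
        term := fun n => if h : ∃ x : Term L P R, (Var.term n, x.code cP cR) ∈ B then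
          some h.choose else none
        sent := fun n => if h : ∃ s : Sentence L P R, (Var.sent n, s.code cP cR) ∈ B then
          some h.choose else none }
    refine ⟨σ, fun b hb => ?_⟩
    obtain ⟨v, x⟩ := b
    have hb' := hB _ hb
    cases v with
    | noun n =>
      obtain ⟨p, rfl⟩ := hb'
      have hp : ∃ p, (Var.noun n, enc (cP p)) ∈ B := ⟨p, hb⟩
      simp only [lookup_noun, σ, dif_pos hp, Option.map_some]
      exact congrArg some (h _ hp.choose_spec _ hb rfl)
    | verb n =>
      obtain ⟨r, rfl⟩ := hb'
      have hr : ∃ r, (Var.verb n, enc (cR r)) ∈ B := ⟨r, hb⟩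
      simp only [lookup_verb, σ, dif_pos hr, Option.map_some]
      exact congrArg some (h _ hr.choose_spec _ hb rfl)
    | term n =>
      obtain ⟨x, rfl⟩ := hb'
      have hx : ∃ x : Term L P R, (Var.term n, x.code cP cR) ∈ B := ⟨x, hb⟩
      simp only [lookup_term, σ, dif_pos hx, Option.map_some]
      exact congrArg some (h _ hx.choose_spec _ hb rfl)
    | sent n =>
      obtain ⟨s, rfl⟩ := hb'
      have hs : ∃ s : Sentence L P R, (Var.sent n, s.code cP cR) ∈ B := ⟨s, hb⟩
      simp only [lookup_sent, σ, dif_pos hs, Option.map_some]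
      exact congrArg some (h _ hs.choose_spec _ hb rfl)

theorem admissible_matches (D : List (Sentence L P R)) (τs : List (SentenceTemplate L)) :
    ∀ B ∈ matches' (D.map (Sentence.code cP cR)) τs, ∀ b ∈ B, Admissible L cP cR b := by
  induction τs with
  | nil => simp [matches']
  | cons τ τs ih =>
    simp only [matches', List.mem_flatMap, List.mem_map, List.mem_filter]
    rintro _ ⟨B, hB, _, ⟨⟨s, -, rfl⟩, hs⟩, rfl⟩
    exact List.forall_mem_append.2 ⟨τ.admissible_bindings s hs, ih B hB⟩

theorem exists_matches_iff (hP : Injective cP) (hR : Injective cR) (σ : Substitution L P R)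
    (D : List (Sentence L P R)) (τs : List (SentenceTemplate L)) :
    (∃ B ∈ matches' (D.map (Sentence.code cP cR)) τs,
      ∀ b ∈ B, σ.lookup cP cR b.1 = some b.2) ↔
    ∃ ps : List (Sentence L P R), (∀ s ∈ ps, s ∈ D) ∧
      τs.mapM (SentenceTemplate.subst σ) = some ps := by
  induction τs with
  | nil => simp [matches']
  | cons τ τs ih =>
    simp only [matches', List.mem_flatMap, List.mem_map, List.mem_filter, List.mapM_cons]
    constructor
    · rintro ⟨_, ⟨B, hB, _, ⟨⟨s, hsD, rfl⟩, hs⟩, rfl⟩, h⟩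
      rw [List.forall_mem_append] at h
      obtain ⟨ps, hps, e⟩ := ih.1 ⟨B, hB, h.2⟩
      have := (SentenceTemplate.subst_eq_some hP hR σ τ s).2 ⟨hs, h.1⟩
      exact ⟨s :: ps, List.forall_mem_cons.2 ⟨hsD, hps⟩, by simp [this, e]⟩
    · rintro ⟨ps, hps, e⟩
      obtain ⟨s, hs, e⟩ := Option.bind_eq_some_iff.1 e
      obtain ⟨ps', hps', e⟩ := Option.bind_eq_some_iff.1 e
      obtain rfl : s :: ps' = ps := Option.some.inj e
      rw [List.forall_mem_cons] at hps
      obtain ⟨B, hB, h⟩ := ih.2 ⟨ps', hps.2, hps'⟩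
      obtain ⟨h₁, h₂⟩ := (SentenceTemplate.subst_eq_some hP hR σ τ s).1 hs
      exact ⟨_, ⟨B, hB, _, ⟨⟨s, hps.1, rfl⟩, h₁⟩, rfl⟩, List.forall_mem_append.2 ⟨h₂, h⟩⟩

/-- A rule applies when premises from `D` and the conclusion have the right shapes and their joint
bindings never give two values to one variable; by `exists_substitution_iff` these then come from a
single substitution. -/
theorem Rule.fires_iff (hP : Injective cP) (hR : Injective cR) (ρ : Rule L)
    (D : List (Sentence L P R)) (φ : Sentence L P R) :
    ρ.fires (D.map (Sentence.code cP cR)) (φ.code cP cR) = true ↔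
      ∃ ps : List (Sentence L P R), (∀ s ∈ ps, s ∈ D) ∧ ρ.IsInstance ps φ := by
  simp only [fires, Bool.and_eq_true, List.any_eq_true, IsInstance]
  constructor
  · rintro ⟨h, B, hB, hc⟩
    obtain ⟨σ, hσ⟩ := (exists_substitution_iff (L := L) (cP := cP) (cR := cR)
      (List.forall_mem_append.2 ⟨ρ.conclusion.admissible_bindings φ h,
        admissible_matches D _ B hB⟩)).2 hc
    rw [List.forall_mem_append] at hσ
    obtain ⟨ps, hps, e⟩ := (exists_matches_iff hP hR σ D ρ.premises).1 ⟨B, hB, hσ.2⟩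
    exact ⟨ps, hps, σ, e, (SentenceTemplate.subst_eq_some hP hR σ _ φ).2 ⟨h, hσ.1⟩⟩
  · rintro ⟨ps, hps, σ, e, hφ⟩
    obtain ⟨h₁, h₂⟩ := (SentenceTemplate.subst_eq_some hP hR σ _ φ).1 hφ
    obtain ⟨B, hB, h⟩ := (exists_matches_iff hP hR σ D ρ.premises).2 ⟨ps, hps, e⟩
    exact ⟨h₁, B, hB, (exists_substitution_iff (L := L) (cP := cP) (cR := cR)
      (List.forall_mem_append.2 ⟨ρ.conclusion.admissible_bindings φ h₁,
        admissible_matches D _ B hB⟩)).1 ⟨σ, List.forall_mem_append.2 ⟨h₂, h⟩⟩⟩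

end Matching
end Syllogistic

namespace Syllogistic
open Function

/-! ### Deciding provability within a finite set of sentences -/

section Derive

variable {L : Language}

/-- Whether `a` belongs to `Γ` or follows from members of `D` by one of the rules. -/
def follows (rs : List (Rule L)) (Γ D : List Tree) (a : Tree) : Bool :=
  (Γ.any fun g => decide (g = a)) || rs.any fun ρ => ρ.fires D a

/-- The members of `A` that belong to `Γ` or follow from members of `D` by one of the rules. -/
def derive (rs : List (Rule L)) (Γ A D : List Tree) : List Tree := A.filter (follows rs Γ D)

/-- The sentences that are derivable from `Γ` within `A`. -/
def derivable (rs : List (Rule L)) (Γ A : List Tree) : List Tree :=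
  A.foldl (fun D _ => derive rs Γ A D) []

variable {P R : Type} {cP : P → List Bool} {cR : R → List Bool}

/-- The analogue of `derive` for sentences. -/
def deriveSentences (cP : P → List Bool) (cR : R → List Bool) (rs : List (Rule L))
    (Γ A D : List (Sentence L P R)) : List (Sentence L P R) :=
  A.filter fun a => follows rs (Γ.map (Sentence.code cP cR)) (D.map (Sentence.code cP cR))
    (a.code cP cR)

theorem derive_map (rs : List (Rule L)) (Γ A D : List (Sentence L P R)) :
    derive rs (Γ.map (Sentence.code cP cR)) (A.map (Sentence.code cP cR))
      (D.map (Sentence.code cP cR)) =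
      (deriveSentences cP cR rs Γ A D).map (Sentence.code cP cR) := by
  rw [derive, List.filter_map]
  rfl

theorem follows_iff (hP : Injective cP) (hR : Injective cR) {rs : List (Rule L)}
    {Γ D : List (Sentence L P R)} {a : Sentence L P R} :
    follows rs (Γ.map (Sentence.code cP cR)) (D.map (Sentence.code cP cR)) (a.code cP cR) = true ↔
      a ∈ Γ ∨ ∃ ρ ∈ rs, ∃ ps : List (Sentence L P R), (∀ s ∈ ps, s ∈ D) ∧ ρ.IsInstance ps a := by
  simp [follows, Rule.fires_iff hP hR, (Sentence.code_injective hP hR).eq_iff]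

theorem mem_deriveSentences (hP : Injective cP) (hR : Injective cR) {rs : List (Rule L)}
    {Γ A D : List (Sentence L P R)} {a : Sentence L P R} :
    a ∈ deriveSentences cP cR rs Γ A D ↔ a ∈ A ∧ (a ∈ Γ ∨
      ∃ ρ ∈ rs, ∃ ps : List (Sentence L P R), (∀ s ∈ ps, s ∈ D) ∧ ρ.IsInstance ps a) := by
  rw [deriveSentences, List.mem_filter, follows_iff hP hR]

theorem foldl_const_eq_iterate {α β : Type} (f : α → α) (l : List β) (a : α) :
    l.foldl (fun c _ => f c) a = f^[l.length] a := by
  induction l generalizing a with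
  | nil => rfl
  | cons b l ih => rw [List.foldl_cons, ih, List.length_cons, iterate_succ_apply]

theorem derivable_map (rs : List (Rule L)) (Γ A : List (Sentence L P R)) :
    derivable rs (Γ.map (Sentence.code cP cR)) (A.map (Sentence.code cP cR)) =
      ((deriveSentences cP cR rs Γ A)^[A.length] []).map (Sentence.code cP cR) := by
  rw [derivable, foldl_const_eq_iterate, List.length_map]
  generalize A.length = n
  induction n with
  | zero => rfl
  | succ n ih => rw [iterate_succ_apply', ih, derive_map, iterate_succ_apply']

/-- The operator is monotone in `D`. All stages are filters of the same list `A`, so inclusion of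
conditions gives sublists, for which equal length means equality. -/
theorem sublist_iterate_deriveSentences (hP : Injective cP) (hR : Injective cR) (rs : List (Rule L))
    (Γ A : List (Sentence L P R)) (n : ℕ) :
    List.Sublist ((deriveSentences cP cR rs Γ A)^[n] [])
      ((deriveSentences cP cR rs Γ A)^[n + 1] []) := by
  induction n with
  | zero => simp
  | succ n ih =>
    rw [iterate_succ_apply', iterate_succ_apply' _ (n + 1)]
    refine List.monotone_filter_right A fun a ha => ?_
    rw [follows_iff hP hR] at ha ⊢
    obtain ha | ⟨ρ, hρ, ps, hps, hi⟩ := ha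
    · exact .inl ha
    · exact .inr ⟨ρ, hρ, ps, fun s hs => ih.subset (hps s hs), hi⟩

theorem deriveSentences_iterate_length (hP : Injective cP) (hR : Injective cR)
    (rs : List (Rule L)) (Γ A : List (Sentence L P R)) :
    deriveSentences cP cR rs Γ A ((deriveSentences cP cR rs Γ A)^[A.length] []) =
      (deriveSentences cP cR rs Γ A)^[A.length] [] := by
  rw [← iterate_succ_apply' (deriveSentences cP cR rs Γ A)]
  -- Until the stages become stationary, each is strictly longer than the one before.
  have key : ∀ n, n ≤ ((deriveSentences cP cR rs Γ A)^[n] []).length ∨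
      (deriveSentences cP cR rs Γ A)^[n + 1] [] = (deriveSentences cP cR rs Γ A)^[n] [] := by
    intro n
    induction n with
    | zero => simp
    | succ n ih =>
      have hs := sublist_iterate_deriveSentences hP hR rs Γ A n
      by_cases h : (deriveSentences cP cR rs Γ A)^[n + 1] [] =
          (deriveSentences cP cR rs Γ A)^[n] []
      · right
        rw [iterate_succ_apply', h, ← iterate_succ_apply' (deriveSentences cP cR rs Γ A)]
        exact h
      · left
        have h₁ := ih.resolve_right h
        have h₂ := hs.length_le
        have h₃ : ((deriveSentences cP cR rs Γ A)^[n] []).length ≠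
          ((deriveSentences cP cR rs Γ A)^[n + 1] []).length := fun e =>
            h (hs.eq_of_length e).symm
        omega
  refine (key A.length).elim (fun h => ?_) fun h => h
  have hs := sublist_iterate_deriveSentences hP hR rs Γ A A.length
  refine (hs.eq_of_length_le ?_).symm
  rw [iterate_succ_apply']
  exact (List.length_filter_le _ _).trans h

/-- Every stage contains only provable sentences; conversely the last stage is a fixed point, hence
closed under the rules within `A`, and induction on the proof tree applies. -/
theorem mem_derivable_iff (hP : Injective cP) (hR : Injective cR) (S : ProofSystem L)
    (Γ A : List (Sentence L P R)) (φ : Sentence L P R) :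
    φ.code cP cR ∈ derivable S.toList (Γ.map (Sentence.code cP cR))
      (A.map (Sentence.code cP cR)) ↔ ProvableWithin S {ψ | ψ ∈ A} {ψ | ψ ∈ Γ} φ := by
  rw [derivable_map, List.mem_map_of_injective (Sentence.code_injective hP hR)]
  constructor
  · generalize A.length = n
    induction n generalizing φ with
    | zero => simp
    | succ n ih =>
      rw [iterate_succ_apply', mem_deriveSentences hP hR]
      rintro ⟨hA, hΓ | ⟨ρ, hρ, ps, hps, hi⟩⟩
      · exact .leaf hA hΓ
      · exact .rule hA ρ (by simpa using hρ) ps hi fun ψ hψ => ih ψ (hps ψ hψ)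
  · intro h
    induction h with
    | leaf hA hΓ =>
      rw [← deriveSentences_iterate_length hP hR, mem_deriveSentences hP hR]
      exact ⟨hA, .inl hΓ⟩
    | rule hA ρ hρ ps hi _ ih =>
      rw [← deriveSentences_iterate_length hP hR, mem_deriveSentences hP hR]
      exact ⟨hA, .inr ⟨ρ, by simpa using hρ, ps, ih, hi⟩⟩

end Derive

/-! ### Matching and forward chaining in polynomial time -/

namespace PT
variable {O : List Letter → List Letter → ℕ → Prop} {α β : Type} [TEnc α] [TEnc β]
  {L : Language}

theorem decide_eq_tree {f g : α → Tree} (hf : PT O f) (hg : PT O g) :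
    PT O (fun x => decide (f x = g x)) :=
  beq (β := Tree) (fun _ _ h => h) hf hg

theorem decide_eq_leaf {f : α → Tree} (hf : PT O f) (a : Letter) :
    PT O (fun x => decide (f x = .leaf a)) := decide_eq_tree hf (const (Tree.leaf a))

theorem termBindings (t : TermTemplate L) {f : α → Tree} (hf : PT O f) :
    PT O (fun x => t.bindings (f x)) := by
  induction t generalizing f with
  | nounVar n => exact cons ((const (Var.noun n)).pair hf.right) (const [])
  | termVar n => exact cons ((const (Var.term n)).pair hf) (const [])
  | allTerm h n t ih => exact cons ((const (Var.verb n)).pair hf.right.left) (ih hf.right.right)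
  | someTerm h n t ih => exact cons ((const (Var.verb n)).pair hf.right.left) (ih hf.right.right)
  | compl h t ih => exact ih hf.right

theorem termShape (t : TermTemplate L) {f : α → Tree} (hf : PT O f) :
    PT O (fun x => t.shape (f x)) := by
  induction t generalizing f with
  | nounVar n => exact decide_eq_leaf hf.left _
  | termVar n => exact const true
  | allTerm h n t ih => exact and (decide_eq_leaf hf.left _) (ih hf.right.right)
  | someTerm h n t ih => exact and (decide_eq_leaf hf.left _) (ih hf.right.right)
  | compl h t ih => exact and (decide_eq_leaf hf.left _) (ih hf.right)

theorem bindingsList (ts : List (TermTemplate L)) {f : α → Tree} (hf : PT O f) :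
    PT O (fun x => bindingsList ts (f x)) := by
  induction ts generalizing f with
  | nil => exact const []
  | cons t ts ih => exact append (termBindings t hf.left) (ih hf.right)

theorem isNone_root {f : α → Tree} (hf : PT O f) : PT O (fun x => (f x).root.isNone) :=
  ((treeRoot fun a => .bit a.isNone).comp hf).of_enc fun _ => rfl

theorem isSome_root {f : α → Tree} (hf : PT O f) : PT O (fun x => (f x).root.isSome) :=
  ((treeRoot fun a => .bit a.isSome).comp hf).of_enc fun _ => rfl

theorem shapeList (ts : List (TermTemplate L)) {f : α → Tree} (hf : PT O f) :
    PT O (fun x => shapeList ts (f x)) := by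
  induction ts generalizing f with
  | nil => exact isSome_root hf.left
  | cons t ts ih => exact and (isNone_root hf.left) (and (termShape t hf.left) (ih hf.right))

theorem bindings (τ : SentenceTemplate L) {f : α → Tree} (hf : PT O f) :
    PT O (fun x => τ.bindings (f x)) := by
  unfold SentenceTemplate.bindings
  cases τ.parts with
  | inl n => exact cons ((const (Var.sent n)).pair hf) (const [])
  | inr z => exact bindingsList z.2 hf.right

theorem shape (τ : SentenceTemplate L) {f : α → Tree} (hf : PT O f) :
    PT O (fun x => τ.shape (f x)) := by
  unfold SentenceTemplate.shape
  cases τ.parts with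
  | inl n => exact const true
  | inr z => exact and (decide_eq_leaf hf.left z.1) (shapeList z.2 hf.right)

theorem consistent {f : α → List (Var × Tree)} (hf : PT O f) :
    PT O (fun x => consistent (f x)) := by
  refine all (c := fun x b => (f x).all fun b' =>
    !decide (b.1 = b'.1) || decide (b.2 = b'.2)) hf ?_
  refine all (l := fun z : α × Var × Tree => f z.1)
    (c := fun z b' => !decide (z.2.1 = b'.1) || decide (z.2.2 = b'.2)) (hf.comp (fst id)) ?_
  exact or (not (beq enc_var_injective (fst (snd (fst id))) (fst (snd id))))
    (decide_eq_tree (snd (snd (fst id))) (snd (snd id)))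

/-- The recursion on the templates takes place outside the computation: every fixed list of premises
has its own program, with a polynomial whose degree may depend on it. -/
theorem matches' (τs : List (SentenceTemplate L)) {D : α → List Tree} (hD : PT O D) :
    PT O (fun x => matches' (D x) τs) := by
  induction τs with
  | nil => exact const [[]]
  | cons τ τs ih =>
    refine flatMap (f := fun x B => ((D x).filter τ.shape).map fun s => τ.bindings s ++ B) ih ?_
    refine map (f := fun (z : α × List (Var × Tree)) s => τ.bindings s ++ z.2)
      (filter (c := fun _ s => τ.shape s) (hD.comp (fst id)) (shape τ (snd id))) ?_
    exact append (bindings τ (snd id)) (snd (fst id))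

theorem fires (ρ : Rule L) {D : α → List Tree} {a : α → Tree} (hD : PT O D) (ha : PT O a) :
    PT O (fun x => ρ.fires (D x) (a x)) := by
  refine and (shape _ ha) (any (c := fun x B =>
    Syllogistic.consistent (ρ.conclusion.bindings (a x) ++ B)) (matches' _ hD) ?_)
  exact consistent (append (bindings _ (ha.comp (fst id))) (snd id))

theorem mem {l : α → List Tree} {a : α → Tree} (hl : PT O l) (ha : PT O a) :
    PT O (fun x => (l x).any fun g => decide (g = a x)) :=
  any (c := fun x g => decide (g = a x)) hl (decide_eq_tree (snd id) (ha.comp (fst id)))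

theorem follows (rs : List (Rule L)) {Γ D : α → List Tree} {a : α → Tree} (hΓ : PT O Γ)
    (hD : PT O D) (ha : PT O a) : PT O (fun x => follows rs (Γ x) (D x) (a x)) := by
  refine or (mem hΓ ha) ?_
  induction rs with
  | nil => exact const false
  | cons ρ rs ih => exact or (fires ρ hD ha) ih

theorem esize_filter_le (l : List β) (c : β → Bool) : esize (l.filter c) ≤ esize l := by
  induction l with
  | nil => rfl
  | cons b l ih =>
    rw [List.filter_cons]
    split_ifs <;> simp <;> omega

theorem derivable (rs : List (Rule L)) {Γ A : α → List Tree} (hΓ : PT O Γ) (hA : PT O A) :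
    PT O (fun x => derivable rs (Γ x) (A x)) := by
  refine foldl (f := fun x D _ => derive rs (Γ x) (A x) D) hA (const []) ?_ hA.esize_le.choose
    fun x c y => ?_
  · refine filter (c := fun (z : α × List Tree × Tree) a =>
      Syllogistic.follows rs (Γ z.1) z.2.1 a) (hA.comp (fst id)) ?_
    exact follows rs (hΓ.comp (fst (fst id))) (fst (snd (fst id))) (snd id)
  -- A round replaces the accumulator by a sublist of `A x`, whose size is polynomial in that of `x`
  -- alone.
  · have h₁ := hA.esize_le.choose_spec x
    have h₂ := esize_filter_le (A x) (Syllogistic.follows rs (Γ x) c)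
    have h₃ := eval_mono hA.esize_le.choose (Nat.le_add_right (esize x) (esize y))
    exact h₂.trans (h₁.trans (h₃.trans (Nat.le_add_left _ _)))

end PT
end Syllogistic

namespace Syllogistic
open Function Filter

/-! ### Compactness -/

section Compactness

variable {L : Language} {P R : Type} {I : Type}

/-- The product of a family of models over an ultrafilter.  There is no need to identify elements,
since there is no equality in the language. -/
def prodModel (U : Ultrafilter I) (M : I → Model P R) : Model P R where
  carrier := ∀ i, (M i).carrier
  noun p := {f | ∀ᶠ i in (U : Filter I), f i ∈ (M i).noun p}
  verb r f g := ∀ᶠ i in (U : Filter I), (M i).verb r (f i) (g i)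

section Product

variable (U : Ultrafilter I) (M : I → Model P R) [∀ i, Nonempty (M i).carrier]

/-- Łoś's theorem for terms. Witnesses in the factors are glued to an element of the product by
`Filter.skolem`, which needs nonempty factors. -/
theorem mem_interp_prodModel (x : Term L P R) (f : ∀ i, (M i).carrier) :
    f ∈ x.interp (prodModel U M) ↔ ∀ᶠ i in (U : Filter I), f i ∈ x.interp (M i) := by
  induction x generalizing f with
  | noun p => rfl
  | allTerm h r x ih =>
    change (∀ g ∈ x.interp (prodModel U M), ∀ᶠ i in (U : Filter I), (M i).verb r (f i) (g i)) ↔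
      ∀ᶠ i in (U : Filter I), ∀ n ∈ x.interp (M i), (M i).verb r (f i) n
    constructor
    -- If the claim fails, an ultrafilter set of indices has counterexamples `n`; glued together
    -- they form an element `g` contradicting `hf`.
    · intro hf
      by_contra hc
      rw [← Ultrafilter.eventually_not] at hc
      have hc' : ∀ᶠ i in (U : Filter I), ∃ n, n ∈ x.interp (M i) ∧ ¬(M i).verb r (f i) n := by
        filter_upwards [hc] with i hi
        push Not at hi
        exact hi
      obtain ⟨g, hg⟩ := Filter.skolem.1 hc'
      have h₁ := hf g ((ih g).2 (hg.mono fun i hi => hi.1))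
      obtain ⟨i, hi, hi'⟩ := (h₁.and hg).exists
      exact hi'.2 hi
    · intro hf g hg
      filter_upwards [hf, (ih g).1 hg] with i hi hi' using hi _ hi'
  | someTerm h r x ih =>
    change (∃ g ∈ x.interp (prodModel U M), ∀ᶠ i in (U : Filter I), (M i).verb r (f i) (g i)) ↔
      ∀ᶠ i in (U : Filter I), ∃ n ∈ x.interp (M i), (M i).verb r (f i) n
    constructor
    · rintro ⟨g, hg, h⟩
      filter_upwards [(ih g).1 hg, h] with i hi hi' using ⟨_, hi, hi'⟩
    · intro hf
      obtain ⟨g, hg⟩ := Filter.skolem.1 hf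
      exact ⟨g, (ih g).2 (hg.mono fun i hi => hi.1), hg.mono fun i hi => hi.2⟩
  | compl h x ih =>
    change ¬f ∈ x.interp (prodModel U M) ↔ ∀ᶠ i in (U : Filter I), ¬f i ∈ x.interp (M i)
    rw [ih, Ultrafilter.eventually_not]

theorem exists_mem_interp_prodModel (xs : List (Term L P R)) :
    (∃ f, ∀ x ∈ xs, f ∈ x.interp (prodModel U M)) ↔
      ∀ᶠ i in (U : Filter I), ∃ m, ∀ x ∈ xs, m ∈ x.interp (M i) := by
  rw [Filter.skolem]
  refine exists_congr fun f => ?_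
  exact (forall₂_congr fun x _ => mem_interp_prodModel U M x f).trans
    (Filter.eventually_all_finite xs.finite_toSet).symm

theorem inter_interp_prodModel (x y : Term L P R) :
    (x.interp (prodModel U M) ∩ y.interp (prodModel U M)).Nonempty ↔
      ∀ᶠ i in (U : Filter I), (x.interp (M i) ∩ y.interp (M i)).Nonempty := by
  simpa [Set.Nonempty] using exists_mem_interp_prodModel U M [x, y]

theorem interp_subset_prodModel (x y : Term L P R) :
    x.interp (prodModel U M) ⊆ y.interp (prodModel U M) ↔
      ∀ᶠ i in (U : Filter I), x.interp (M i) ⊆ y.interp (M i) := by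
  -- Negated, inclusion becomes the existence of a counterexample, which can be glued from the
  -- factors.
  rw [← not_iff_not, ← Ultrafilter.eventually_not]
  simp only [Set.not_subset]
  rw [Filter.skolem]
  refine exists_congr fun f => ?_
  exact (and_congr (mem_interp_prodModel U M x f) ((not_congr (mem_interp_prodModel U M y f)).trans
    Ultrafilter.eventually_not.symm)).trans eventually_and.symm

theorem holds_prodModel (ψ : Sentence L P R) :
    ψ.Holds (prodModel U M) ↔ ∀ᶠ i in (U : Filter I), ψ.Holds (M i) := by
  cases ψ with
  | all h x y => exact interp_subset_prodModel U M x y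
  | some h x y => exact inter_interp_prodModel U M x y
  | allOrSome h a b x y =>
    simp only [Sentence.Holds, Ultrafilter.eventually_or, interp_subset_prodModel,
      inter_interp_prodModel]
  | disjoint h x xs =>
    simp only [Sentence.Holds, ← Set.not_nonempty_iff_eq_empty, Ultrafilter.eventually_not]
    exact not_congr (exists_mem_interp_prodModel U M (x :: xs))
  | overlap h x xs => exact exists_mem_interp_prodModel U M (x :: xs)

end Product

theorem holds_iff_of_isEmpty (N N' : Model P R) [IsEmpty N.carrier] [IsEmpty N'.carrier]
    (ψ : Sentence L P R) : ψ.Holds N ↔ ψ.Holds N' := by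
  cases ψ <;> simp [Sentence.Holds, Set.eq_empty_of_isEmpty]

/-- Either almost all factors are nonempty, and the others may be replaced by a one-point model, or
almost all are empty, and any empty model serves, since empty models satisfy the same sentences. -/
theorem exists_holds_iff_eventually (U : Ultrafilter I) (M : I → Model P R) :
    ∃ N : Model P R, ∀ ψ : Sentence L P R, ψ.Holds N ↔ ∀ᶠ i in (U : Filter I), ψ.Holds (M i) := by
  classical
  by_cases h : ∀ᶠ i in (U : Filter I), Nonempty (M i).carrier
  · let M' : I → Model P R := fun i =>
      if Nonempty (M i).carrier then M i else ⟨Unit, fun _ => ∅, fun _ _ _ => False⟩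
    have hM' : ∀ i, Nonempty (M' i).carrier := by
      intro i
      by_cases hi : Nonempty (M i).carrier
      · simp only [M', if_pos hi]; exact hi
      · simp only [M', if_neg hi]; infer_instance
    refine ⟨prodModel U M', fun ψ => (holds_prodModel U M' ψ).trans ?_⟩
    refine eventually_congr (h.mono fun i hi => ?_)
    simp only [M', if_pos hi, iff_self]
  · rw [← Ultrafilter.eventually_not] at h
    refine ⟨⟨Empty, fun _ => ∅, fun _ _ _ => False⟩, fun ψ => ?_⟩
    have key : ∀ᶠ i in (U : Filter I), (ψ.Holds (⟨Empty, fun _ => ∅, fun _ _ _ => False⟩ : Model P R)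
        ↔ ψ.Holds (M i)) := by
      filter_upwards [h] with i hi
      have : IsEmpty (M i).carrier := not_nonempty_iff.1 hi
      have : IsEmpty (⟨Empty, fun _ => ∅, fun _ _ _ => False⟩ : Model P R).carrier :=
        inferInstanceAs (IsEmpty Empty)
      exact holds_iff_of_isEmpty _ _ ψ
    rw [← eventually_congr key, eventually_const]

/-- The compactness theorem. -/
theorem Entails.exists_finset {Γ : Set (Sentence L P R)} {φ : Sentence L P R} (h : Entails Γ φ) :
    ∃ Δ : Finset (Sentence L P R), (Δ : Set (Sentence L P R)) ⊆ Γ ∧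
      Entails (Δ : Set (Sentence L P R)) φ := by
  classical
  by_contra! hc
  let J := {Δ : Finset (Sentence L P R) // (Δ : Set (Sentence L P R)) ⊆ Γ}
  have hJ : ∀ Δ : J, ∃ M : Model P R, (∀ ψ ∈ Δ.1, ψ.Holds M) ∧ ¬φ.Holds M := by
    intro Δ
    have := hc Δ.1 Δ.2
    simp only [Entails, not_forall, Finset.mem_coe] at this
    obtain ⟨M, h₁, h₂⟩ := this
    exact ⟨M, h₁, h₂⟩
  choose M hM hφ using hJ
  have : Nonempty J := ⟨⟨∅, by simp⟩⟩
  have : IsDirectedOrder J := ⟨fun a b =>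
    ⟨⟨a.1 ∪ b.1, by simpa using ⟨a.2, b.2⟩⟩, Finset.subset_union_left, Finset.subset_union_right⟩⟩
  -- For each `ψ ∈ Γ` the finite subsets containing `ψ` form a set in `atTop`, hence in `U`, so the
  -- limit model satisfies all of `Γ`.
  let U : Ultrafilter J := Ultrafilter.of atTop
  obtain ⟨N, hN⟩ := exists_holds_iff_eventually (L := L) U M
  have h₁ : φ.Holds N := by
    refine h N fun ψ hψ => (hN ψ).2 ?_
    have : ∀ᶠ Δ : J in atTop, ψ.Holds (M Δ) := by
      filter_upwards [eventually_ge_atTop (⟨{ψ}, by simpa using hψ⟩ : J)] with Δ hΔ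
      exact hM Δ ψ (hΔ (Finset.mem_singleton_self ψ))
    exact Ultrafilter.of_le atTop this
  obtain ⟨Δ, hΔ⟩ := ((hN φ).1 h₁).exists
  exact hφ Δ hΔ

theorem ProvableWithin.mono {S : ProofSystem L} {A A' Γ Γ' : Set (Sentence L P R)}
    {φ : Sentence L P R} (h : ProvableWithin S A Γ φ) (hA : A ⊆ A') (hΓ : Γ ⊆ Γ') :
    ProvableWithin S A' Γ' φ := by
  induction h with
  | leaf h₁ h₂ => exact .leaf (hA h₁) (hΓ h₂)
  | rule h₁ ρ hρ ps hi _ ih => exact .rule (hA h₁) ρ hρ ps hi ih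

end Compactness
end Syllogistic

namespace Syllogistic
open Function Turing

/-! ### The output of a machine is not much longer than its running time -/

section Growth

variable {K : Type} [DecidableEq K] {Γ : K → Type} {Λ σ : Type}

/-- A bound on the number of symbols that a statement pushes. -/
def pushes : TM2.Stmt Γ Λ σ → ℕ
  | .push _ _ q => pushes q + 1
  | .peek _ _ q => pushes q
  | .pop _ _ q => pushes q
  | .load _ q => pushes q
  | .branch _ q₁ q₂ => max (pushes q₁) (pushes q₂)
  | .goto _ => 0
  | .halt => 0

theorem length_stk_stepAux (q : TM2.Stmt Γ Λ σ) (v : σ) (Z : ∀ k, List (Γ k)) (n : ℕ)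
    (hZ : ∀ k, (Z k).length ≤ n) (k : K) :
    ((TM2.stepAux q v Z).stk k).length ≤ n + pushes q := by
  induction q generalizing v Z n with
  | push k' f q ih =>
    refine (ih _ _ (n + 1) fun j => ?_).trans (by simp only [pushes]; omega)
    by_cases h : j = k'
    · subst h; simpa using hZ j
    · simpa [h] using (hZ j).trans n.le_succ
  | peek k' f q ih => exact ih _ _ n hZ
  | pop k' f q ih =>
    refine ih _ _ n fun j => ?_
    by_cases h : j = k'
    · subst h; simpa using (Nat.sub_le _ _).trans (hZ j)
    · simpa [h] using hZ j
  | load f q ih => exact ih _ _ n hZ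
  | branch f q₁ q₂ ih₁ ih₂ =>
    simp only [TM2.stepAux, pushes]
    cases f v
    · exact (ih₂ _ _ n hZ).trans (by omega)
    · exact (ih₁ _ _ n hZ).trans (by omega)
  | goto f => exact hZ k
  | halt => exact hZ k

theorem length_stk_of_steps {M : Λ → TM2.Stmt Γ Λ σ} {C : ℕ} (hC : ∀ l, pushes (M l) ≤ C) {n : ℕ}
    {c c' : TM2.Cfg Γ Λ σ} (h : Steps (TM2.step M) n c c') (m : ℕ)
    (hc : ∀ k, (c.stk k).length ≤ m) (k : K) : (c'.stk k).length ≤ m + n * C := by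
  induction n generalizing c m with
  | zero => cases h; simpa using hc k
  | succ n ih =>
    obtain ⟨b, hb, h⟩ := h.exists_head
    obtain ⟨_ | l, v, Z⟩ := c
    · cases hb
    · cases hb
      refine (ih h (m + C) fun j => ?_).trans (by rw [Nat.succ_mul]; omega)
      exact (length_stk_stepAux (M l) v Z m hc j).trans (Nat.add_le_add_left (hC l) m)

end Growth

/-- One step may push several symbols, but at most as many as the statement at its label contains;
the sum over the finitely many labels is a uniform bound. -/
theorem Oracle.exists_length_le (A : Oracle) :
    ∃ C : ℕ, ∀ {s s' : List Letter} {t : ℕ}, A.Answers s s' t → s'.length ≤ s.length + t * C := by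
  have := A.tm.ΛFin
  refine ⟨∑ l, pushes (A.tm.m l), ?_⟩
  rintro s s' t ⟨n, hn, h⟩
  rw [initList_eq, haltList_eq] at h
  have h₁ := length_stk_of_steps (M := A.tm.m) (C := ∑ l, pushes (A.tm.m l))
    (fun l => Finset.single_le_sum (f := fun l => pushes (A.tm.m l)) (fun _ _ => Nat.zero_le _)
      (Finset.mem_univ l)) h s.length (fun k => ?_) A.tm.k₁
  · have h₂ := Nat.mul_le_mul_right (∑ l, pushes (A.tm.m l)) hn
    simp at h₁
    omega
  · by_cases hk : k = A.tm.k₀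
    · subst hk; simp
    · simp [hk]

theorem PT.of_tm2ComputableInPolyTime {α β : Type} {e : α → List Letter} {e' : β → List Letter}
    {F : α → β} (h : TM2ComputableInPolyTime e e' F) :
    PT (Oracle.Answers h.toTM2ComputableAux) (fun x : Word e => e' (F x.val)) := by
  obtain ⟨C, hC⟩ := Oracle.exists_length_le h.toTM2ComputableAux
  refine PT.call (f := fun x => e' (F x))
    (h.time + (Polynomial.X + h.time * Polynomial.C C)) fun x => ?_
  have hx : Oracle.Answers h.toTM2ComputableAux (e x) (e' (F x)) (h.time.eval (e x).length) :=
    ⟨_, (h.outputsFun x).steps_le_m, (h.outputsFun x).evals_in_steps⟩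
  exact ⟨_, hx, by simpa using hC hx⟩

/-! ### The main theorem -/

section Main

variable {L : Language} {P R : Type} {cP : P → List Bool} {cR : R → List Bool} {S : ProofSystem L}

theorem BoundedlyComplete.complete (hS : BoundedlyComplete cP cR S) : Complete P R S := by
  obtain ⟨-, f, -, hf⟩ := hS
  intro Γ φ h
  obtain ⟨Δ, hΔ, h'⟩ := h.exists_finset
  exact (hf Δ φ h').mono (Set.subset_univ _) hΔ

/-- The decision procedure: derive what can be derived from `Γ` within the sentences of `F (Γ, φ)`,
and look whether `φ` is among it. -/
noncomputable def decideEntails (cP : P → List Bool) (cR : R → List Bool) (S : ProofSystem L)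
    (F : List (Sentence L P R) → List (Sentence L P R))
    (i : List (Sentence L P R) × Sentence L P R) : Bool :=
  (derivable S.toList (i.1.reverse.map (Sentence.code cP cR))
    ((F (i.1 ++ [i.2])).map (Sentence.code cP cR))).any fun g => decide (g = i.2.code cP cR)

theorem decideEntails_iff (hP : Injective cP) (hR : Injective cR)
    (F : List (Sentence L P R) → List (Sentence L P R)) (Γ : List (Sentence L P R))
    (φ : Sentence L P R) :
    decideEntails cP cR S F (Γ, φ) = true ↔
      ProvableWithin S {ψ | ψ ∈ F (Γ ++ [φ])} {ψ | ψ ∈ Γ} φ := by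
  have h := mem_derivable_iff hP hR S Γ.reverse (F (Γ ++ [φ])) φ
  simp only [List.mem_reverse] at h
  rw [← h]
  simp [decideEntails]

/-- The only use of the oracle is through `hF`; everything else is composed from the closure
properties of `PT`. -/
theorem PT.decideEntails {O : List Letter → List Letter → ℕ → Prop}
    {F : List (Sentence L P R) → List (Sentence L P R)}
    (hF : PT O (fun x : Word (encodeTheory (L := L) cP cR) => encodeTheory cP cR (F x.val))) :
    PT O (fun x : Word (encodeInput (L := L) cP cR) => decideEntails cP cR S F x.val) := by
  have hw : PT O (fun x : Word (encodeInput (L := L) cP cR) => encodeInput cP cR x.val) :=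
    PT.id.of_enc fun _ => rfl
  have hp (x : Word (encodeInput (L := L) cP cR)) :=
    parse_encodeInput (cP := cP) (cR := cR) x.val.1 x.val.2
  have hrev := PT.reverse (PT.parse hw)
  -- Reversed, the parsed input begins with `φ` and the dummy sentence of the separator. `Γ` is left
  -- in reverse order, since only membership in it matters.
  have hΓ : PT O (fun x : Word (encodeInput (L := L) cP cR) =>
      x.val.1.reverse.map (Sentence.code cP cR)) := by
    have h := PT.tail (PT.tail hrev)
    simp only [hp] at h
    simpa using h
  have hφ : PT O (fun x : Word (encodeInput (L := L) cP cR) => x.val.2.code cP cR) := by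
    have h := PT.headD hrev
    simp only [hp] at h
    simpa using h
  have hΓφ : PT O (fun x : Word (encodeInput (L := L) cP cR) =>
      (⟨x.val.1 ++ [x.val.2]⟩ : Word (encodeTheory (L := L) cP cR))) := by
    refine (PT.filter (c := fun _ a => !decide (a = Letter.turnstile)) hw (PT.not (PT.beq
      (fun a b h => by simpa using h) (PT.snd PT.id) (PT.const _)))).of_enc fun x => ?_
    exact congrArg enc (filter_encodeInput x.val.1 x.val.2).symm
  have hA := PT.parse (hF.comp hΓφ)
  simp only [parse_encodeTheory] at hA
  exact PT.mem (PT.derivable S.toList hΓ hA) hφ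

/-- Soundness makes the procedure accept only consequences, and the bound `f` makes it find them
all. Injectivity of the name codes lets equality of sentences be tested on trees. -/
theorem BoundedlyComplete.consequenceInPTime (hP : Injective cP) (hR : Injective cR)
    (hS : BoundedlyComplete cP cR S) : ConsequenceInPTime L cP cR := by
  classical
  obtain ⟨hsound, f, ⟨F, hF, ⟨h⟩⟩, hf⟩ := hS
  refine ⟨decideEntails cP cR S F, fun Γ φ => ?_,
    polyTime_of_pt (PT.decideEntails (PT.of_tm2ComputableInPolyTime h))⟩
  rw [decideEntails_iff hP hR]
  refine ⟨fun hp => hsound _ _ (hp.mono (Set.subset_univ _) subset_rfl), fun he => ?_⟩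
  have hp := hf Γ.toFinset φ (by simpa using he)
  refine hp.mono (fun ψ hψ => ?_) fun ψ hψ => by simpa using hψ
  -- `F` represents `f` on every list of the elements of a set, in particular on `Γ ++ [φ]`, even if
  -- it has repetitions.
  have e : f (Γ.toFinset ∪ {φ}) = (F (Γ ++ [φ])).toFinset := by
    rw [hF]
    congr 1
    ext
    simp
  have hψ' : ψ ∈ (F (Γ ++ [φ])).toFinset := by
    rw [← e]
    exact Finset.mem_coe.1 hψ
  simpa using hψ'

end Main

end Syllogistic

theorem mainTheorem11 (L : Syllogistic.Language) (P R : Type)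
    (cP : P → List Bool) (hcP : Function.Injective cP)
    (cR : R → List Bool) (hcR : Function.Injective cR)
    (S : Syllogistic.ProofSystem L) (hS : Syllogistic.BoundedlyComplete cP cR S) :
    Syllogistic.Complete P R S ∧ Syllogistic.ConsequenceInPTime L cP cR :=
  ⟨hS.complete, hS.consequenceInPTime hcP hcR⟩
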